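/- **Notation.** For $z=(x,\omega)\in\mathbb{R}^{2d}$ let $\pi(z)\psi(t)=e^{2\pi i\omega\cdot t}\psi(t-x)$ on $L^2(\mathbb{R}^d)$, let $V_\varphi\psi(z)=\langle\psi,\pi(z)\varphi\rangle_{L^2}$, and let $\varphi_0(t)=2^{d/4}e^{-\pi t\cdot t}$. Let $v$ be a submultiplicative weight: a non-negative, continuous function on $\mathbb{R}^{2d}$, not identically zero, with $v(z_1+z_2)\le v(z_1)v(z_2)$ and $v(x,\omega)=v(-x,\omega)=v(x,-\omega)$. A $v$-moderate weight is a non-negative Lebesgue measurable function $m$ on $\mathbb{R}^{2d}$ such that, for some constant $C>0$, $m(z_1+z_2)\le C\,v(z_1)m(z_2)$ for all $z_1,z_2$. Let $M^1_v(\mathbb{R}^d)$ be the space of $\psi\in L^2(\mathbb{R}^d)$ with $\|\psi\|_{M^1_v}=\int_{\mathbb{R}^{2d}}|V_{\varphi_0}\psi(z)|v(z)\,dz<\infty$, let $(M^1_v)'$ be the space of bounded antilinear functionals on it, and let $L^1_v(\mathbb{R}^{2d})$ be the space of measurable $f$ with $\int|f|v<\infty$. For $\psi\in(M^1_v)'$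 put $V_{\varphi_0}\psi(z)=\langle\psi,\pi(z)\varphi_0\rangle_{(M^1_v)',M^1_v}$ and, for $1\le p,q\le\infty$, $$\|\psi\|_{M^{p,q}_m}=\Big(\int_{\mathbb{R}^d}\Big(\int_{\mathbb{R}^d}|V_{\varphi_0}\psi(x,\omega)|^p m(x,\omega)^p\,dx\Big)^{q/p}d\omega\Big)^{1/q}\in[0,\infty],$$ with essential suprema in place of the integrals if $p=\infty$ or $q=\infty$. The modulation space $M^{p,q}_m(\mathbb{R}^d)$ consists of the $\psi\in(M^1_v)'$ for which this is finite. For $\varphi_1\in M^1_v(\mathbb{R}^d)$, $\varphi_2\in L^2(\mathbb{R}^d)$ and $f\in L^1_v(\mathbb{R}^{2d})$, the localization operator is the bounded operator $$\mathcal{A}^{\varphi_1,\varphi_2}_f\psi=\int_{\mathbb{R}^{2d}}f(z)\,V_{\varphi_1}\psi(z)\,\pi(z)\varphi_2\,dz$$ on $L^2(\mathbb{R}^d)$; it extends to $\psi\in(M^1_v)'$, with values in $L^2(\mathbb{R}^d)$, by $\langle\mathcal{A}^{\varphi_1,\varphi_2}_f\psi,\phi\rangle_{L^2}=\langle\psi,(\mathcal{A}^{\varphi_1,\varphi_2}_f)^*\phi\rangle_{(M^1_v)',M^1_v}$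 for all $\phi\in L^2(\mathbb{R}^d)$. Finally, $T_zf(w)=f(w-z)$. **Theorem.** Let $\varphi_1\in M^1_v(\mathbb{R}^d)$, $\varphi_2\in L^2(\mathbb{R}^d)$ and $f\in L^1_v(\mathbb{R}^{2d})$ be such that $\mathcal{A}^{\varphi_1,\varphi_2}_f\neq0$. Let $1\le p,q\le\infty$ and let $m$ be a $v$-moderate weight. Then for every $\psi\in(M^1_v)'$ the map $z\mapsto\mathcal{A}^{\varphi_1,\varphi_2}_{T_zf}\psi$ from $\mathbb{R}^{2d}$ to $L^2(\mathbb{R}^d)$ is strongly Lebesgue measurable, and there are constants $c,C>0$ such that for all $\psi\in(M^1_v)'$ $$c\,\|\psi\|_{M^{p,q}_m}\le\Big(\int_{\mathbb{R}^d}\Big(\int_{\mathbb{R}^d}\big\|\mathcal{A}^{\varphi_1,\varphi_2}_{T_{(x,\omega)}f}\psi\big\|_{L^2}^p\,m(x,\omega)^p\,dx\Big)^{q/p}d\omega\Big)^{1/q}\le C\,\|\psi\|_{M^{p,q}_m}$$ in $[0,\infty]$, with essential suprema in place of the integrals if $p=\infty$ or $q=\infty$. In particular, $M^{p,q}_m(\mathbb{R}^d)$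 consists exactly of those $\psi\in(M^1_v)'$ for which the middle term is finite, and the middle term is an equivalent norm on it (a seminorm if $m\equiv0$). -/

import Mathlib

open MeasureTheory Filter Topology
open scoped ENNReal ComplexConjugate

noncomputable section

namespace TimeFreq

/-- `ℝᵈ`. -/
abbrev Rd (d : ℕ) : Type := EuclideanSpace ℝ (Fin d)

/-- The time-frequency plane `ℝ²ᵈ`, with points `z = (x, ω)`. Its `volume` is Lebesgue measure. -/
abbrev Phase (d : ℕ) : Type := Rd d × Rd d

/-- `L²(ℝᵈ)`, complex valued. -/
abbrev L2 (d : ℕ) : Type := Lp ℂ 2 (volume : Measure (Rd d))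

/-! ### Time-frequency shifts -/

/-- The character `e^{2πi ω·t}`. -/
def character {d : ℕ} (ω t : Rd d) : ℂ :=
  Complex.exp (2 * Real.pi * Complex.I * (inner ℝ ω t : ℝ))

theorem norm_character {d : ℕ} (ω t : Rd d) : ‖character ω t‖ = 1 := by
  have : character ω t = Complex.exp ((2 * Real.pi * inner ℝ ω t : ℝ) * Complex.I) := by
    unfold character; congr 1; push_cast; ring
  rw [this, Complex.norm_exp_ofReal_mul_I]

theorem continuous_character {d : ℕ} :
    Continuous (fun q : Rd d × Rd d => character q.1 q.2) := by
  unfold character; fun_prop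

theorem memLp_tfShift {d : ℕ} (z : Phase d) (ψ : L2 d) :
    MemLp (fun t => character z.2 t * ψ (t - z.1)) 2 (volume : Measure (Rd d)) := by
  have h : MemLp (fun t => ψ (t - z.1)) 2 (volume : Measure (Rd d)) :=
    (Lp.memLp ψ).comp_measurePreserving (measurePreserving_sub_right volume z.1)
  refine h.of_le (AEStronglyMeasurable.mul ?_ h.1) (ae_of_all _ fun t => ?_)
  · exact (continuous_character.comp (Continuous.prodMk_right z.2)).aestronglyMeasurable
  · simp [norm_character]

/-- The time-frequency shift `π(x, ω)ψ(t) = e^{2πi ω·t} ψ(t - x)` on `L²(ℝᵈ)`. -/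
def tfShift {d : ℕ} (z : Phase d) (ψ : L2 d) : L2 d := (memLp_tfShift z ψ).toLp

theorem coeFn_tfShift {d : ℕ} (z : Phase d) (ψ : L2 d) :
    tfShift z ψ =ᵐ[volume] fun t => character z.2 t * ψ (t - z.1) :=
  (memLp_tfShift z ψ).coeFn_toLp

theorem sub_ae {d : ℕ} (x : Rd d) {P : Rd d → Prop} (h : ∀ᵐ t ∂(volume : Measure (Rd d)), P t) :
    ∀ᵐ t ∂(volume : Measure (Rd d)), P (t - x) :=
  (measurePreserving_sub_right volume x).quasiMeasurePreserving.ae h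

theorem tfShift_sub {d : ℕ} (z : Phase d) (ψ χ : L2 d) :
    tfShift z (ψ - χ) = tfShift z ψ - tfShift z χ := by
  ext1
  filter_upwards [coeFn_tfShift z (ψ - χ), coeFn_tfShift z ψ, coeFn_tfShift z χ,
    Lp.coeFn_sub (tfShift z ψ) (tfShift z χ), sub_ae z.1 (Lp.coeFn_sub ψ χ)] with t h1 h2 h3 h4 h5
  rw [h1, h4, h5, Pi.sub_apply, Pi.sub_apply, h2, h3, mul_sub]

theorem norm_tfShift {d : ℕ} (z : Phase d) (ψ : L2 d) : ‖tfShift z ψ‖ = ‖ψ‖ := by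
  have h1 : ‖tfShift z ψ‖ =
      ‖Lp.compMeasurePreserving _ (measurePreserving_sub_right volume z.1) ψ‖ := by
    rw [Lp.norm_def, Lp.norm_def]
    congr 1
    refine eLpNorm_congr_norm_ae ?_
    filter_upwards [coeFn_tfShift z ψ,
      Lp.coeFn_compMeasurePreserving ψ (measurePreserving_sub_right volume z.1)] with t h1 h2
    rw [h1, h2]; simp [norm_character]
  rw [h1, Lp.norm_compMeasurePreserving]

/-- Strong continuity of the time-frequency shifts. -/
theorem continuous_tfShift {d : ℕ} (ψ : L2 d) : Continuous (fun z : Phase d => tfShift z ψ) := by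
  -- translation part
  have hT : Continuous (fun x : Rd d =>
      Lp.compMeasurePreserving _ (measurePreserving_sub_right (volume : Measure (Rd d)) x) ψ) := by
    let g : C(Rd d, C(Rd d, Rd d)) :=
      (ContinuousMap.mk (fun a : Rd d × Rd d => a.2 - a.1) (by fun_prop)).curry
    exact Continuous.compMeasurePreservingLp (g := fun x => g x)
      (continuous_const (y := ψ)) g.continuous
      (fun x => measurePreserving_sub_right volume x) (by simp)
  have hT' : ∀ x : Rd d, tfShift (x, 0) ψ =
      Lp.compMeasurePreserving _ (measurePreserving_sub_right (volume : Measure (Rd d)) x) ψ := by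
    intro x
    ext1
    filter_upwards [coeFn_tfShift (x, 0) ψ,
      Lp.coeFn_compMeasurePreserving ψ (measurePreserving_sub_right volume x)] with t h1 h2
    rw [h1, h2]; simp [character]
  -- modulation part
  have hM : ∀ χ : L2 d, Continuous (fun ω : Rd d => tfShift (0, ω) χ) := by
    intro χ
    rw [continuous_iff_continuousAt]
    intro ω₀
    unfold ContinuousAt tfShift
    rw [Lp.tendsto_Lp_iff_tendsto_eLpNorm'']
    simp only [sub_zero]
    have key : Tendsto (fun ω : Rd d => ∫⁻ t, ‖(character ω t - character ω₀ t) * χ t‖ₑ ^ (2 : ℝ))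
        (𝓝 ω₀) (𝓝 (∫⁻ _ : Rd d, 0)) := by
      refine tendsto_lintegral_filter_of_dominated_convergence
        (fun t => (2 * ‖χ t‖ₑ) ^ (2 : ℝ)) ?_ ?_ ?_ ?_
      · refine Eventually.of_forall fun ω => ?_
        have h1 : Continuous (fun t : Rd d => character ω t - character ω₀ t) :=
          (continuous_character.comp (Continuous.prodMk_right ω)).sub
            (continuous_character.comp (Continuous.prodMk_right ω₀))
        exact ((h1.measurable.mul (Lp.stronglyMeasurable χ).measurable).enorm).pow_const _
      · refine Eventually.of_forall fun ω => ae_of_all _ fun t => ?_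
        gcongr
        rw [enorm_mul]
        gcongr
        rw [← ofReal_norm]
        refine (ENNReal.ofReal_le_ofReal ((norm_sub_le _ _).trans ?_)).trans_eq
          (ENNReal.ofReal_ofNat 2)
        rw [norm_character, norm_character]; norm_num
      · have h2 := (Lp.memLp χ).eLpNorm_lt_top
        have h3 := lintegral_rpow_enorm_lt_top_of_eLpNorm_lt_top (by simp) (by simp) h2
        simp only [ENNReal.toReal_ofNat] at h3
        simp_rw [ENNReal.mul_rpow_of_nonneg _ _ (by norm_num : (0 : ℝ) ≤ 2)]
        rw [lintegral_const_mul' _ _ (by simp)]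
        exact (ENNReal.mul_lt_top (by simp) h3).ne
      · refine ae_of_all _ fun t => ?_
        have hc : Continuous (fun ω : Rd d =>
            ‖(character ω t - character ω₀ t) * χ t‖ₑ ^ (2 : ℝ)) := by
          have h1 : Continuous (fun ω : Rd d => (character ω t - character ω₀ t) * χ t) :=
            ((continuous_character.comp (Continuous.prodMk_left t)).sub continuous_const).mul
              continuous_const
          exact (ENNReal.continuous_rpow_const).comp h1.enorm
        simpa using hc.tendsto ω₀
    simp only [lintegral_zero] at key
    have key2 := (ENNReal.continuous_rpow_const (y := (1 / 2 : ℝ))).tendsto 0 |>.comp key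
    simp only [one_div, ENNReal.zero_rpow_of_pos (by norm_num : (0 : ℝ) < 2⁻¹)] at key2
    refine key2.congr fun ω => ?_
    rw [eLpNorm_eq_lintegral_rpow_enorm_toReal (by simp) (by simp)]
    simp only [Function.comp_apply, ENNReal.toReal_ofNat, one_div, Pi.sub_apply, sub_mul]
  -- composition
  have hcomp : ∀ (z : Phase d) (χ : L2 d), tfShift z χ = tfShift (0, z.2) (tfShift (z.1, 0) χ) := by
    intro z χ
    ext1
    filter_upwards [coeFn_tfShift z χ, coeFn_tfShift (0, z.2) (tfShift (z.1, 0) χ),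
      coeFn_tfShift (z.1, 0) χ] with t h1 h2 h3
    rw [h1, h2, sub_zero, h3]; simp [character]
  rw [continuous_iff_continuousAt]
  intro z₀
  have hfun : (fun z : Phase d => tfShift z ψ) = fun z =>
      tfShift (0, z.2) (tfShift (z.1, 0) ψ - tfShift (z₀.1, 0) ψ)
        + tfShift (0, z.2) (tfShift (z₀.1, 0) ψ) := by
    funext z
    rw [hcomp z ψ, tfShift_sub]; abel
  have hT1 : Continuous (fun x : Rd d => tfShift (x, 0) ψ) := by simpa only [hT'] using hT
  have hz : Tendsto (fun z : Phase d =>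
      tfShift (0, z.2) (tfShift (z.1, 0) ψ - tfShift (z₀.1, 0) ψ)) (𝓝 z₀) (𝓝 0) := by
    rw [tendsto_zero_iff_norm_tendsto_zero]
    simp_rw [norm_tfShift]
    have : Continuous (fun z : Phase d => ‖tfShift (z.1, 0) ψ - tfShift (z₀.1, 0) ψ‖) :=
      ((hT1.comp continuous_fst).sub continuous_const).norm
    simpa using this.tendsto z₀
  have hw : Tendsto (fun z : Phase d => tfShift (0, z.2) (tfShift (z₀.1, 0) ψ)) (𝓝 z₀)
      (𝓝 (tfShift (0, z₀.2) (tfShift (z₀.1, 0) ψ))) :=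
    ((hM (tfShift (z₀.1, 0) ψ)).comp continuous_snd).tendsto z₀
  change Tendsto (fun z : Phase d => tfShift z ψ) (𝓝 z₀) (𝓝 (tfShift z₀ ψ))
  rw [hfun, hcomp z₀ ψ]
  simpa using hz.add hw

/-! ### The short-time Fourier transform on `L²` -/

/-- The short-time Fourier transform `V_φ ψ(z) = ⟨ψ, π(z)φ⟩`. (Mathlib's inner product is
antilinear in its first argument.) -/
def stft {d : ℕ} (φ ψ : L2 d) (z : Phase d) : ℂ := inner ℂ (tfShift z φ) ψ

theorem continuous_stft {d : ℕ} (φ ψ : L2 d) : Continuous (stft φ ψ) :=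
  (continuous_tfShift φ).inner continuous_const

theorem norm_stft_le {d : ℕ} (φ ψ : L2 d) (z : Phase d) : ‖stft φ ψ z‖ ≤ ‖φ‖ * ‖ψ‖ :=
  (norm_inner_le_norm _ _).trans_eq (by rw [norm_tfShift])

theorem norm_stft_tfShift {d : ℕ} (φ ψ : L2 d) (w z : Phase d) :
    ‖stft φ (tfShift z ψ) w‖ = ‖stft φ ψ (w - z)‖ := by
  have h1 : stft φ (tfShift z ψ) w = ∫ t, character z.2 t * ψ (t - z.1) *
      conj (character w.2 t * φ (t - w.1)) := by
    unfold stft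
    rw [L2.inner_def]
    refine integral_congr_ae ?_
    filter_upwards [coeFn_tfShift z ψ, coeFn_tfShift w φ] with t h1 h2
    rw [h1, h2]; rfl
  have h2 : stft φ ψ (w - z) = ∫ t, ψ t *
      conj (character (w - z).2 t * φ (t - (w - z).1)) := by
    unfold stft
    rw [L2.inner_def]
    refine integral_congr_ae ?_
    filter_upwards [coeFn_tfShift (w - z) φ] with t h1
    rw [h1]; rfl
  rw [h1, h2, ← integral_sub_right_eq_self (fun t => ψ t *
      conj (character (w - z).2 t * φ (t - (w - z).1))) z.1]
  have h3 : ∀ t, character z.2 t * ψ (t - z.1) * conj (character w.2 t * φ (t - w.1)) =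
      character (z.2 - w.2) z.1 *
      (ψ (t - z.1) * conj (character (w - z).2 (t - z.1) * φ (t - z.1 - (w - z).1))) := by
    intro t
    have e1 : t - z.1 - (w - z).1 = t - w.1 := by simp
    have e2 : character z.2 t * conj (character w.2 t) =
        character (z.2 - w.2) z.1 * conj (character (w - z).2 (t - z.1)) := by
      unfold character
      rw [← Complex.exp_conj, ← Complex.exp_conj, ← Complex.exp_add, ← Complex.exp_add]
      congr 1
      simp only [map_mul, Complex.conj_ofReal, Complex.conj_I, Prod.snd_sub, inner_sub_left,
        inner_sub_right, map_ofNat]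
      push_cast
      ring
    rw [e1, map_mul, map_mul]
    linear_combination (ψ (t - z.1) * conj (φ (t - w.1))) * e2
  simp_rw [h3]
  rw [integral_const_mul, norm_mul, norm_character, one_mul]

/-! ### Weights -/

/-- Submultiplicative weight functions on `ℝ²ᵈ`: non-negative, continuous, symmetric in each of
the variables `x` and `ω`, and not identically zero. -/
structure SubmultWeight (d : ℕ) where
  /-- the weight as a function -/
  toFun : Phase d → ℝ
  nonneg' : ∀ z, 0 ≤ toFun z
  continuous' : Continuous toFun
  submul' : ∀ z₁ z₂, toFun (z₁ + z₂) ≤ toFun z₁ * toFun z₂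
  symm_left' : ∀ x ω, toFun (-x, ω) = toFun (x, ω)
  symm_right' : ∀ x ω, toFun (x, -ω) = toFun (x, ω)
  ne_zero' : ∃ z, toFun z ≠ 0

instance {d : ℕ} : CoeFun (SubmultWeight d) (fun _ => Phase d → ℝ) := ⟨SubmultWeight.toFun⟩

/-- `m` is a `v`-moderate weight: a non-negative Lebesgue measurable function with
`m(z₁ + z₂) ≤ C v(z₁) m(z₂)` for some constant `C > 0`. -/
structure IsModerate {d : ℕ} (v : SubmultWeight d) (m : Phase d → ℝ) : Prop where
  nonneg : ∀ z, 0 ≤ m z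
  aemeasurable : AEMeasurable m volume
  moderate : ∃ C : ℝ, 0 < C ∧ ∀ z₁ z₂, m (z₁ + z₂) ≤ C * v z₁ * m z₂

theorem SubmultWeight.one_le {d : ℕ} (v : SubmultWeight d) (z : Phase d) : 1 ≤ v z := by
  obtain ⟨y, hy⟩ := v.ne_zero'
  have hpos : 0 < v z := by
    rcases (v.nonneg' z).lt_or_eq with h | h
    · exact h
    · exfalso
      apply hy
      have h1 := v.submul' z (y - z)
      rw [← h, zero_mul, add_sub_cancel] at h1
      exact le_antisymm h1 (v.nonneg' y)
  have h0 : v z ≤ v z * v 0 := by simpa using v.submul' z 0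
  have h0' : 1 ≤ v 0 := by
    by_contra hlt
    push Not at hlt
    nlinarith
  have hs : v (-z) = v z := (v.symm_left' z.1 (-z.2)).trans (v.symm_right' z.1 z.2)
  have h2 : v 0 ≤ v z * v z := by simpa [hs] using v.submul' z (-z)
  nlinarith

/-- A submultiplicative weight grows at most exponentially. -/
theorem SubmultWeight.exp_bound {d : ℕ} (v : SubmultWeight d) :
    ∃ C a : ℝ, 0 < C ∧ 0 ≤ a ∧ ∀ z, v z ≤ C * Real.exp (a * ‖z‖) := by
  obtain ⟨B, hB⟩ := (isCompact_closedBall (0 : Phase d) 1).exists_bound_of_continuousOn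
    v.continuous'.continuousOn
  have hB' : ∀ u : Phase d, ‖u‖ ≤ 1 → v u ≤ B := fun u hu =>
    (le_abs_self _).trans (hB u (by simpa using hu))
  have hB1 : 1 ≤ B := (v.one_le 0).trans (hB' 0 (by simp))
  have hpow : ∀ (n : ℕ) (u : Phase d), v (((n : ℝ) + 1) • u) ≤ v u ^ (n + 1) := by
    intro n u
    induction n with
    | zero => simp
    | succ k ih =>
      have : (((k + 1 : ℕ) : ℝ) + 1) • u = ((k : ℝ) + 1) • u + u := by
        push_cast; rw [add_smul ((k : ℝ) + 1), one_smul]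
      rw [this, pow_succ]
      exact (v.submul' _ _).trans (mul_le_mul_of_nonneg_right ih (v.nonneg' _))
  refine ⟨B, Real.log B, by linarith, Real.log_nonneg hB1, fun z => ?_⟩
  set n := ⌊‖z‖⌋₊ with hn
  have hn1 : ‖z‖ < n + 1 := Nat.lt_floor_add_one _
  have hn2 : (n : ℝ) ≤ ‖z‖ := Nat.floor_le (norm_nonneg _)
  have hpos : (0 : ℝ) < n + 1 := by positivity
  have hu : ‖((n : ℝ) + 1)⁻¹ • z‖ ≤ 1 := by
    rw [norm_smul, norm_inv, Real.norm_of_nonneg hpos.le, inv_mul_le_iff₀ hpos]; linarith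
  have h1 := hpow n (((n : ℝ) + 1)⁻¹ • z)
  rw [smul_inv_smul₀ hpos.ne'] at h1
  refine h1.trans ((pow_le_pow_left₀ (v.nonneg' _) (hB' _ hu) _).trans ?_)
  rw [pow_succ, mul_comm]
  refine mul_le_mul_of_nonneg_left ?_ (by linarith)
  rw [← Real.rpow_natCast, Real.rpow_def_of_pos (by linarith)]
  exact Real.exp_le_exp.mpr (mul_le_mul_of_nonneg_left hn2 (Real.log_nonneg hB1))

/-! ### The Gaussian -/

theorem memLp_gaussian (d : ℕ) :
    MemLp (fun t : Rd d => (((2 : ℝ) ^ ((d : ℝ) / 4) * Real.exp (-Real.pi * ‖t‖ ^ 2) : ℝ) : ℂ)) 2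
      (volume : Measure (Rd d)) := by
  rw [memLp_two_iff_integrable_sq_norm (by fun_prop)]
  have h := (GaussianFourier.integrable_cexp_neg_mul_sq_norm_add (V := Rd d)
    (b := ((2 * Real.pi : ℝ) : ℂ)) (by simpa using Real.pi_pos) 0 0).norm.const_mul
    (((2 : ℝ) ^ ((d : ℝ) / 4)) ^ 2)
  refine h.congr (ae_of_all _ fun t => ?_)
  have e : Complex.exp (-((2 * Real.pi : ℝ) : ℂ) * (‖t‖ : ℂ) ^ 2 + 0 * ((inner ℝ (0 : Rd d) t : ℝ) : ℂ))
      = ((Real.exp (-(2 * Real.pi) * ‖t‖ ^ 2) : ℝ) : ℂ) := by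
    push_cast; congr 1; ring
  simp only [e, Complex.norm_real, Real.norm_eq_abs, sq_abs, Real.abs_exp]
  rw [mul_pow, ← Real.exp_nat_mul]
  congr 2
  push_cast; ring

/-- The `L²`-normalized Gaussian `φ₀(t) = 2^{d/4} e^{-π t·t}`. -/
def gaussian (d : ℕ) : L2 d := (memLp_gaussian d).toLp

/-- The short-time Fourier transform of the Gaussian decays like a Gaussian. -/
theorem exists_norm_stft_gaussian (d : ℕ) : ∃ K : ℝ, ∀ z : Phase d,
    ‖stft (gaussian d) (gaussian d) z‖ =
      K * (Real.exp (-(Real.pi / 2) * ‖z.1‖ ^ 2) * Real.exp (-(Real.pi / 2) * ‖z.2‖ ^ 2)) := by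
  set c : ℝ := (2 : ℝ) ^ ((d : ℝ) / 4) with hc
  have hcoe : gaussian d =ᵐ[volume] fun t : Rd d =>
      ((c * Real.exp (-Real.pi * ‖t‖ ^ 2) : ℝ) : ℂ) := (memLp_gaussian d).coeFn_toLp
  refine ⟨c ^ 2 * ‖((Real.pi : ℂ) / ((2 * Real.pi : ℝ) : ℂ)) ^
    ((Module.finrank ℝ (Rd d) : ℂ) / 2)‖, fun z => ?_⟩
  have h1 : stft (gaussian d) (gaussian d) z = ∫ t : Rd d,
      ((c * Real.exp (-Real.pi * ‖t‖ ^ 2) : ℝ) : ℂ) *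
      conj (character z.2 t * ((c * Real.exp (-Real.pi * ‖t - z.1‖ ^ 2) : ℝ) : ℂ)) := by
    unfold stft
    rw [L2.inner_def]
    refine integral_congr_ae ?_
    filter_upwards [coeFn_tfShift z (gaussian d), hcoe, sub_ae z.1 hcoe] with t h1 h2 h3
    rw [h1, h2, h3]; rfl
  have h2 : ∀ t : Rd d, ((c * Real.exp (-Real.pi * ‖t‖ ^ 2) : ℝ) : ℂ) *
      conj (character z.2 t * ((c * Real.exp (-Real.pi * ‖t - z.1‖ ^ 2) : ℝ) : ℂ)) =
      ((c ^ 2 * Real.exp (-(Real.pi / 2) * ‖z.1‖ ^ 2) : ℝ) : ℂ) *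
        conj (character z.2 ((1 / 2 : ℝ) • z.1)) *
      (fun s : Rd d => Complex.exp (-((2 * Real.pi : ℝ) : ℂ) * (‖s‖ : ℂ) ^ 2 +
        (-(2 * Real.pi * Complex.I)) * ((inner ℝ z.2 s : ℝ) : ℂ))) (t - (1 / 2 : ℝ) • z.1) := by
    intro t
    have e1 : ‖t - z.1‖ ^ 2 = ‖t‖ ^ 2 - 2 * inner ℝ t z.1 + ‖z.1‖ ^ 2 := norm_sub_sq_real t z.1
    have e2 : ‖t - (1 / 2 : ℝ) • z.1‖ ^ 2 = ‖t‖ ^ 2 - inner ℝ t z.1 + ‖z.1‖ ^ 2 / 4 := by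
      rw [norm_sub_sq_real, norm_smul, inner_smul_right, mul_pow]
      norm_num; ring
    have e2' : (‖t - (1 / 2 : ℝ) • z.1‖ : ℂ) ^ 2 =
        (‖t‖ : ℂ) ^ 2 - ((inner ℝ t z.1 : ℝ) : ℂ) + (‖z.1‖ : ℂ) ^ 2 / 4 := by
      exact_mod_cast congrArg (fun r : ℝ => (r : ℂ)) e2
    simp only [character, map_mul, Complex.conj_ofReal]
    rw [← Complex.exp_conj, ← Complex.exp_conj, e1, e2']
    push_cast
    have e3 : ∀ A B D E F G : ℂ, A + B + D = E + F + G →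
        (c : ℂ) * Complex.exp A * (Complex.exp B * ((c : ℂ) * Complex.exp D)) =
        (c : ℂ) ^ 2 * Complex.exp E * Complex.exp F * Complex.exp G := by
      intro A B D E F G h
      have := congrArg Complex.exp h
      rw [Complex.exp_add, Complex.exp_add, Complex.exp_add, Complex.exp_add] at this
      linear_combination (c : ℂ) ^ 2 * this
    apply e3
    simp only [map_mul, Complex.conj_ofReal, Complex.conj_I, inner_sub_right, inner_smul_right,
      map_ofNat]
    push_cast
    ring
  rw [h1]
  simp_rw [h2]
  rw [integral_const_mul, integral_sub_right_eq_self
    (fun s : Rd d => Complex.exp (-((2 * Real.pi : ℝ) : ℂ) * (‖s‖ : ℂ) ^ 2 +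
        (-(2 * Real.pi * Complex.I)) * ((inner ℝ z.2 s : ℝ) : ℂ))),
    GaussianFourier.integral_cexp_neg_mul_sq_norm_add (by simpa using Real.pi_pos)]
  have e4 : Complex.exp ((-(2 * Real.pi * Complex.I)) ^ 2 * (‖z.2‖ : ℂ) ^ 2 /
      (4 * ((2 * Real.pi : ℝ) : ℂ))) = ((Real.exp (-(Real.pi / 2) * ‖z.2‖ ^ 2) : ℝ) : ℂ) := by
    have hpi : (Real.pi : ℂ) ≠ 0 := by exact_mod_cast Real.pi_ne_zero
    push_cast
    congr 1
    field_simp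
    rw [Complex.I_sq]; ring
  rw [e4, norm_mul, norm_mul, norm_mul, RCLike.norm_conj, norm_character, Complex.norm_real,
    Complex.norm_real, Real.norm_of_nonneg (by positivity), Real.norm_of_nonneg (by positivity)]
  ring

/-! ### The space `M¹_v` and its dual -/

/-- The space `M¹_v(ℝᵈ)` of all `ψ ∈ L²(ℝᵈ)` with `∫ |V_{φ₀}ψ(z)| v(z) dz < ∞`. -/
def M1 {d : ℕ} (v : SubmultWeight d) : Submodule ℂ (L2 d) where
  carrier := {ψ | Integrable (fun z => ‖stft (gaussian d) ψ z‖ * v z) volume}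
  zero_mem' := by simp [stft]
  add_mem' := by
    intro a b ha hb
    refine (Integrable.add ha hb).mono'
      ((continuous_stft _ _).norm.mul v.continuous').aestronglyMeasurable
      (ae_of_all _ fun z => ?_)
    rw [Real.norm_of_nonneg (mul_nonneg (norm_nonneg _) (v.nonneg' z)), Pi.add_apply, ← add_mul]
    refine mul_le_mul_of_nonneg_right ?_ (v.nonneg' z)
    simp only [stft, inner_add_right]
    exact norm_add_le _ _
  smul_mem' := by
    intro c a ha
    refine (Integrable.const_mul ha ‖c‖).congr (ae_of_all _ fun z => ?_)
    simp only [stft, inner_smul_right, norm_mul, mul_assoc]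

theorem mem_M1 {d : ℕ} {v : SubmultWeight d} {ψ : L2 d} :
    ψ ∈ M1 v ↔ Integrable (fun z => ‖stft (gaussian d) ψ z‖ * v z) volume := Iff.rfl

/-- `‖ψ‖_{M¹_v} = ∫ |V_{φ₀}ψ(z)| v(z) dz`. -/
def m1Norm {d : ℕ} (v : SubmultWeight d) (ψ : M1 v) : ℝ :=
  ∫ z, ‖stft (gaussian d) (ψ : L2 d) z‖ * v z

theorem tfShift_mem_M1 {d : ℕ} (v : SubmultWeight d) (z : Phase d) {ψ : L2 d} (hψ : ψ ∈ M1 v) :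
    tfShift z ψ ∈ M1 v := by
  rw [mem_M1] at hψ ⊢
  have : (volume : Measure (Phase d)).IsAddRightInvariant := by
    rw [Measure.volume_eq_prod]; infer_instance
  refine ((hψ.comp_sub_right z).mul_const (v z)).mono'
    ((continuous_stft _ _).norm.mul v.continuous').aestronglyMeasurable
    (ae_of_all _ fun w => ?_)
  rw [Real.norm_of_nonneg (mul_nonneg (norm_nonneg _) (v.nonneg' w)), norm_stft_tfShift, mul_assoc]
  refine mul_le_mul_of_nonneg_left ?_ (norm_nonneg _)
  simpa using v.submul' (w - z) z

theorem gaussian_mem_M1 {d : ℕ} (v : SubmultWeight d) : gaussian d ∈ M1 v := by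
  rw [mem_M1]
  obtain ⟨K, hK⟩ := exists_norm_stft_gaussian d
  obtain ⟨C, a, hC, ha, hv⟩ := v.exp_bound
  have hK0 : 0 ≤ K := by
    have := hK 0
    simp only [Prod.fst_zero, Prod.snd_zero, norm_zero] at this
    norm_num at this
    rw [← this]; exact norm_nonneg _
  have hg : ∀ r : ℝ, 0 ≤ r → -(Real.pi / 2) * r ^ 2 + a * r ≤ a ^ 2 - (1 / 4) * r ^ 2 := by
    intro r _
    nlinarith [sq_nonneg (a - r / 2), Real.pi_gt_three, sq_nonneg r]
  have hint : Integrable (fun t : Rd d => Real.exp (a ^ 2 - (1 / 4) * ‖t‖ ^ 2)) volume := by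
    have h := (GaussianFourier.integrable_cexp_neg_mul_sq_norm_add (V := Rd d)
      (b := ((1 / 4 : ℝ) : ℂ)) (by simp) 0 0).norm.const_mul (Real.exp (a ^ 2))
    refine h.congr (ae_of_all _ fun t => ?_)
    have e : Complex.exp (-((1 / 4 : ℝ) : ℂ) * (‖t‖ : ℂ) ^ 2 +
        0 * ((inner ℝ (0 : Rd d) t : ℝ) : ℂ)) = ((Real.exp (-(1 / 4) * ‖t‖ ^ 2) : ℝ) : ℂ) := by
      push_cast; congr 1; ring
    simp only [e, Complex.norm_real, Real.norm_eq_abs, Real.abs_exp]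
    rw [← Real.exp_add]; congr 1; ring
  refine ((hint.mul_prod hint).const_mul (K * C)).mono'
    ((continuous_stft _ _).norm.mul v.continuous').aestronglyMeasurable
    (ae_of_all _ fun z => ?_)
  rw [Real.norm_of_nonneg (mul_nonneg (norm_nonneg _) (v.nonneg' z)), hK z]
  have hz : ‖z‖ ≤ ‖z.1‖ + ‖z.2‖ := by
    rw [Prod.norm_def]
    exact max_le (by linarith [norm_nonneg z.2]) (by linarith [norm_nonneg z.1])
  have h1 : v z ≤ C * (Real.exp (a * ‖z.1‖) * Real.exp (a * ‖z.2‖)) := by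
    refine (hv z).trans (mul_le_mul_of_nonneg_left ?_ hC.le)
    rw [← Real.exp_add, ← mul_add]
    exact Real.exp_le_exp.mpr (mul_le_mul_of_nonneg_left hz ha)
  calc K * (Real.exp (-(Real.pi / 2) * ‖z.1‖ ^ 2) * Real.exp (-(Real.pi / 2) * ‖z.2‖ ^ 2)) * v z
      ≤ K * (Real.exp (-(Real.pi / 2) * ‖z.1‖ ^ 2) * Real.exp (-(Real.pi / 2) * ‖z.2‖ ^ 2)) *
        (C * (Real.exp (a * ‖z.1‖) * Real.exp (a * ‖z.2‖))) := by gcongr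
    _ = K * C * (Real.exp (-(Real.pi / 2) * ‖z.1‖ ^ 2 + a * ‖z.1‖) *
        Real.exp (-(Real.pi / 2) * ‖z.2‖ ^ 2 + a * ‖z.2‖)) := by
        rw [Real.exp_add, Real.exp_add]; ring
    _ ≤ K * C * (Real.exp (a ^ 2 - (1 / 4) * ‖z.1‖ ^ 2) *
        Real.exp (a ^ 2 - (1 / 4) * ‖z.2‖ ^ 2)) := by
        have := hg ‖z.1‖ (norm_nonneg _)
        have := hg ‖z.2‖ (norm_nonneg _)
        gcongr

/-- `φ₀` as an element of `M¹_v`. -/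
def m1Gaussian {d : ℕ} (v : SubmultWeight d) : M1 v := ⟨gaussian d, gaussian_mem_M1 v⟩

/-- `π(z)` on `M¹_v`. -/
def m1Shift {d : ℕ} (v : SubmultWeight d) (z : Phase d) (φ : M1 v) : M1 v :=
  ⟨tfShift z (φ : L2 d), tfShift_mem_M1 v z φ.2⟩

/-- The dual space `(M¹_v)' = M^∞_{1/v}`: the bounded antilinear functionals on `M¹_v`. The value
`ψ.bracket φ` is the duality bracket `⟨ψ, φ⟩`, antilinear in `φ`. -/
structure M1Dual {d : ℕ} (v : SubmultWeight d) where
  /-- the duality bracket with a fixed functional -/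
  bracket : M1 v →ₗ⋆[ℂ] ℂ
  bounded' : ∃ C : ℝ, ∀ φ : M1 v, ‖bracket φ‖ ≤ C * m1Norm v φ

/-- The short-time Fourier transform `V_φ ψ(z) = ⟨ψ, π(z)φ⟩` for `φ ∈ M¹_v`, `ψ ∈ (M¹_v)'`. -/
def M1Dual.stft {d : ℕ} {v : SubmultWeight d} (φ : M1 v) (ψ : M1Dual v) (z : Phase d) : ℂ :=
  ψ.bracket (m1Shift v z φ)

/-! ### Mixed norms and modulation space norms -/

/-- The weighted mixed norm `(∫ (∫ ‖F(x, ω)‖^p m(x, ω)^p dx)^{q/p} dω)^{1/q}` in `[0, ∞]`, with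
essential suprema in place of the integrals for `p = ∞` or `q = ∞`. -/
def mixedNorm {d : ℕ} {X : Type*} [NormedAddCommGroup X] (p q : ℝ≥0∞) (m : Phase d → ℝ)
    (F : Phase d → X) : ℝ≥0∞ :=
  eLpNorm (fun ω : Rd d => eLpNorm (fun x : Rd d => ‖F (x, ω)‖ * m (x, ω)) p volume) q volume

/-- `‖ψ‖_{M^{p,q}_m} = ‖V_{φ₀}ψ‖_{L^{p,q}_m}` for `ψ ∈ (M¹_v)'`; the modulation space `M^{p,q}_m`
consists of those `ψ` for which it is finite. -/
def modNorm {d : ℕ} {v : SubmultWeight d} (p q : ℝ≥0∞) (m : Phase d → ℝ) (ψ : M1Dual v) : ℝ≥0∞ :=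
  mixedNorm p q m (M1Dual.stft (m1Gaussian v) ψ)

/-! ### Localization operators -/

/-- `f ∈ L¹_v(ℝ²ᵈ)`. -/
def MemL1 {d : ℕ} (v : SubmultWeight d) (f : Phase d → ℂ) : Prop :=
  AEStronglyMeasurable f volume ∧ Integrable (fun z => ‖f z‖ * v z) volume

/-- The translate `T_z f(w) = f(w - z)`. -/
def translate {d : ℕ} (z : Phase d) (f : Phase d → ℂ) : Phase d → ℂ := fun w => f (w - z)

/-- The localization operator
`A_f^{φ₁,φ₂} = ∫ f(z) (π(z)φ₂ ⊗ π(z)φ₁) dz`, a Bochner integral of rank-one operators on `L²(ℝᵈ)`;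
see `locOp_apply` for its action on functions. -/
def locOp {d : ℕ} (φ₁ φ₂ : L2 d) (f : Phase d → ℂ) : L2 d →L[ℂ] L2 d :=
  ∫ z, f z • InnerProductSpace.rankOne ℂ (tfShift z φ₂) (tfShift z φ₁)

/-- `A_f^{φ₁,φ₂} ψ = ∫ f(z) V_{φ₁}ψ(z) π(z)φ₂ dz`. -/
theorem locOp_apply {d : ℕ} (φ₁ φ₂ : L2 d) {f : Phase d → ℂ} (hf : Integrable f volume)
    (ψ : L2 d) : locOp φ₁ φ₂ f ψ = ∫ z, (f z * stft φ₁ ψ z) • tfShift z φ₂ := by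
  have hc : Continuous (fun z : Phase d =>
      InnerProductSpace.rankOne ℂ (tfShift z φ₂) (tfShift z φ₁)) :=
    ((ContinuousLinearMap.smulRightL ℂ (L2 d) (L2 d)).continuous.comp
      ((innerSL ℂ).continuous.comp (continuous_tfShift φ₁))).clm_apply (continuous_tfShift φ₂)
  have hi : Integrable (fun z : Phase d =>
      f z • InnerProductSpace.rankOne ℂ (tfShift z φ₂) (tfShift z φ₁)) volume := by
    refine (hf.norm.mul_const (‖φ₂‖ * ‖φ₁‖)).mono' (hf.1.smul hc.aestronglyMeasurable)
      (ae_of_all _ fun z => ?_)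
    rw [norm_smul, InnerProductSpace.norm_rankOne, norm_tfShift, norm_tfShift]
  unfold locOp
  rw [ContinuousLinearMap.integral_apply hi]
  refine integral_congr_ae (ae_of_all _ fun z => ?_)
  simp [stft, smul_smul]

theorem MemL1.integrable {d : ℕ} {v : SubmultWeight d} {f : Phase d → ℂ} (hf : MemL1 v f) :
    Integrable f volume :=
  hf.2.mono' hf.1 (ae_of_all _ fun z => le_mul_of_one_le_right (norm_nonneg _) (v.one_le z))

/-- `w = S ψ` for the extension of `S ∈ ℒ(L²)` to `ψ ∈ (M¹_v)'`: the adjoint `S*` maps `L²` into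
`M¹_v`, and `⟨w, φ⟩_{L²} = ⟨ψ, S*φ⟩_{(M¹_v)', M¹_v}` for all `φ ∈ L²`. -/
def IsExtValue {d : ℕ} {v : SubmultWeight d} (S : L2 d →L[ℂ] L2 d) (ψ : M1Dual v) (w : L2 d) :
    Prop :=
  ∀ φ : L2 d, ∃ h : ContinuousLinearMap.adjoint S φ ∈ M1 v, inner ℂ φ w = ψ.bracket ⟨_, h⟩

theorem IsExtValue.unique {d : ℕ} {v : SubmultWeight d} {S : L2 d →L[ℂ] L2 d} {ψ : M1Dual v}
    {w w' : L2 d} (h : IsExtValue S ψ w) (h' : IsExtValue S ψ w') : w = w' := by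
  refine ext_inner_left ℂ fun φ => ?_
  obtain ⟨_, e⟩ := h φ
  obtain ⟨_, e'⟩ := h' φ
  rw [e, e']

open Classical in
/-- The extension of `S ∈ ℒ(L²)` to an operator `(M¹_v)' → L²`, by duality. (The value `0` is used
only when there is no `w` with `IsExtValue S ψ w`; for `S = A_f^{φ₁,φ₂}` with `φ₁ ∈ M¹_v`,
`φ₂ ∈ L²`, `f ∈ L¹_v` there always is one.) -/
def extend {d : ℕ} {v : SubmultWeight d} (S : L2 d →L[ℂ] L2 d) (ψ : M1Dual v) : L2 d :=
  if h : ∃ w, IsExtValue S ψ w then h.choose else 0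

theorem IsExtValue.extend_eq {d : ℕ} {v : SubmultWeight d} {S : L2 d →L[ℂ] L2 d} {ψ : M1Dual v}
    {w : L2 d} (h : IsExtValue S ψ w) : extend S ψ = w := by
  have hex : ∃ w, IsExtValue S ψ w := ⟨w, h⟩
  unfold extend
  rw [dif_pos hex]
  exact hex.choose_spec.unique h

end TimeFreq

end

/-! Everything is compared with $|V_\xi\psi|$ for a suitable window $\xi\in M^1_v$, and replacing
one nonzero window by another costs only a constant in $L^{p,q}_m$.

Lower bound: since $\mathcal A_f\neq0$, some $\xi=\mathcal A_f^*\phi$ is nonzero, and it lies in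
$M^1_v$. Covariance, $\mathcal A_{T_zf}^*\pi(z)=\pi(z)\mathcal A_f^*$ (`adjoint_locOp_translate`),
gives $|V_\xi\psi(z)|=|\langle\mathcal A_{T_zf}\psi,\pi(z)\phi\rangle|\le\|\phi\|\,\|\mathcal
A_{T_zf}\psi\|$ (`enorm_stft_adjoint_le`). So the middle term dominates the modulation norm taken
with window $\xi$, hence the one taken with $\varphi_0$.

Upper bound: on $(M^1_v)'$ the operator is still given by its defining integral
(`isExtValue_locOp`), so $\|\mathcal
A_{T_zf}\psi\|\le\|\varphi_2\|\int|f(u)|\,|V_{\varphi_1}\psi(z+u)|\,du$. Young's inequality with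
$f\in L^1_v$ (`emixedNorm_correlation_le`) and a change of window from $\varphi_0$ to $\varphi_1$
finish it.

The change of window (`M1Dual.norm_sq_mul_bracket`, `M1Dual.emixedNorm_stft_le`) combines Moyal's
identity with an integral representation of the functionals in $(M^1_v)'$ (`M1Dual.exists_density`),
obtained from Hahn–Banach and the duality of $L^1$ and $L^\infty$. Its error kernel $V_\xi g$ is in
$L^1_v$, so Young's inequality applies again. -/

noncomputable section

/-! ### Minkowski's integral inequality -/

/-- The `L^p` norm in one variable is a measurable function of the other. -/
theorem measurable_eLpNorm_prod_left {α β : Type*} [MeasurableSpace α] [MeasurableSpace β]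
    {μ : Measure α} [SFinite μ] {G : α × β → ℝ≥0∞} (hG : Measurable G) (p : ℝ≥0∞) :
    Measurable fun y => eLpNorm (fun x => G (x, y)) p μ := by
  rcases eq_or_ne p 0 with rfl | hp0
  · simp
  rcases eq_or_ne p ∞ with rfl | hpt
  · simp only [eLpNorm_exponent_top, eLpNormEssSup, enorm_eq_self]
    -- The essential supremum exceeds `a` exactly when the slice of `{a < G}` has positive measure,
    -- and the measure of a slice is measurable in `y`.
    refine measurable_of_Ioi fun a => ?_
    have : (fun y => essSup (fun x => G (x, y)) μ) ⁻¹' Set.Ioi a =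
        {y | 0 < μ ((fun x => (x, y)) ⁻¹' {q : α × β | a < G q})} := by
      ext y
      simp only [Set.mem_preimage, Set.mem_Ioi, Set.mem_ofPred_eq, Set.preimage_ofPred_eq]
      rw [pos_iff_ne_zero, ← not_le, ← not_iff_not, not_not, not_not]
      refine ⟨fun h => ?_, fun h => essSup_le_of_ae_le _ ?_⟩
      · have h2 : ∀ᵐ x ∂μ, G (x, y) ≤ a :=
          (ae_le_essSup (f := fun x => G (x, y))).mono fun x hx => hx.trans h
        simpa [ae_iff] using h2
      · have : ∀ᵐ x ∂μ, G (x, y) ≤ a := by simpa [ae_iff] using h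
        exact this
    rw [this]
    exact measurableSet_lt measurable_const
      (measurable_measure_prodMk_right (measurableSet_lt measurable_const hG))
  · simp only [eLpNorm_eq_lintegral_rpow_enorm_toReal hp0 hpt, enorm_eq_self]
    exact ((hG.pow_const p.toReal).lintegral_prod_left').pow_const _

/-- **Minkowski's integral inequality** for `ℝ≥0∞`-valued functions. -/
theorem eLpNorm_lintegral_le {α β : Type*} [MeasurableSpace α] [MeasurableSpace β]
    {μ : Measure α} {ν : Measure β} [SFinite μ] [SFinite ν] {G : α × β → ℝ≥0∞}
    (hG : Measurable G) {p : ℝ≥0∞} (hp : 1 ≤ p) :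
    eLpNorm (fun x => ∫⁻ y, G (x, y) ∂ν) p μ ≤ ∫⁻ y, eLpNorm (fun x => G (x, y)) p μ ∂ν := by
  have hNm := measurable_eLpNorm_prod_left (μ := μ) hG p
  rcases eq_or_ne p ∞ with rfl | hpt
  · simp only [eLpNorm_exponent_top, eLpNormEssSup, enorm_eq_self] at hNm ⊢
    refine essSup_le_of_ae_le _ ?_
    have h1 : ∀ᵐ y ∂ν, ∀ᵐ x ∂μ, G (x, y) ≤ essSup (fun x => G (x, y)) μ :=
      ae_of_all _ fun y => ae_le_essSup (f := fun x => G (x, y))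
    have h2 := (Measure.ae_ae_comm (μ := μ) (ν := ν)
      (p := fun x y => G (x, y) ≤ essSup (fun x => G (x, y)) μ)
      (measurableSet_le hG (hNm.comp measurable_snd))).2 h1
    filter_upwards [h2] with x hx
    exact lintegral_mono_ae hx
  have hp0 : p ≠ 0 := (zero_lt_one.trans_le hp).ne'
  set r := p.toReal with hr
  have hr1 : 1 ≤ r := by simpa using ENNReal.toReal_mono hpt hp
  have hr0 : 0 < r := by linarith
  obtain ⟨N, hNdef⟩ : ∃ N : β → ℝ≥0∞, N = fun y => eLpNorm (fun x => G (x, y)) p μ := ⟨_, rfl⟩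
  rw [← hNdef] at hNm ⊢
  have hNr : ∀ y, ∫⁻ x, G (x, y) ^ r ∂μ = N y ^ r := fun y => by
    rw [hNdef]
    simp only [eLpNorm_eq_lintegral_rpow_enorm_toReal hp0 hpt, enorm_eq_self, ← hr]
    rw [← ENNReal.rpow_mul, one_div, inv_mul_cancel₀ hr0.ne', ENNReal.rpow_one]
  have hGr : ∀ y, Measurable fun x => G (x, y) := fun y => hG.comp measurable_prodMk_right
  have hQ : Measurable fun q : α × β => G q / N q.2 := hG.div (hNm.comp measurable_snd)
  have hQl : ∀ x, Measurable fun y => G (x, y) / N y := fun x => hQ.comp measurable_prodMk_left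
  have hQr : ∀ y, Measurable fun x => G (x, y) / N y := fun y => hQ.comp measurable_prodMk_right
  set I := ∫⁻ y, N y ∂ν with hI
  rcases eq_or_ne I ∞ with hIt | hIt
  · rw [hIt]; exact le_top
  have hfin : ∀ᵐ y ∂ν, N y < ∞ := ae_lt_top hNm hIt
  -- Division by `N y` is harmless: `N y = ∞` only on a null set because `I` is finite, and if `N y
  -- = 0` then `G (·, y)` vanishes almost everywhere.
  have hfac : ∀ᵐ x ∂μ, ∀ᵐ y ∂ν, G (x, y) = N y * (G (x, y) / N y) := by
    refine (Measure.ae_ae_comm (p := fun x y => G (x, y) = N y * (G (x, y) / N y))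
      (measurableSet_eq_fun hG ((hNm.comp measurable_snd).mul
        (hG.div (hNm.comp measurable_snd))))).2 ?_
    filter_upwards [hfin] with y hy
    rcases eq_or_ne (N y) 0 with h0 | h0
    · have h1 : ∫⁻ x, G (x, y) ^ r ∂μ = 0 := by rw [hNr, h0, ENNReal.zero_rpow_of_pos hr0]
      rw [lintegral_eq_zero_iff ((hGr y).pow_const r)] at h1
      filter_upwards [h1] with x hx
      have : G (x, y) = 0 := by simpa [hr0, hr0.not_gt] using hx
      simp [this]
    · exact ae_of_all _ fun x => (ENNReal.mul_div_cancel h0 hy.ne).symm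
  -- Hölder for `G / N` on the measure `N dν`, whose total mass is `I`. After integration in `x` the
  -- normalized slices `G / N` contribute at most `1` each.
  have hpt' : ∀ᵐ x ∂μ, (∫⁻ y, G (x, y) ∂ν) ^ r ≤
      I ^ (r - 1) * ∫⁻ y, N y * (G (x, y) / N y) ^ r ∂ν := by
    filter_upwards [hfac] with x hx
    have h1 : ∫⁻ y, G (x, y) ∂ν = ∫⁻ y, G (x, y) / N y ∂(ν.withDensity N) := by
      rw [lintegral_withDensity_eq_lintegral_mul _ hNm (hQl x)]
      exact lintegral_congr_ae hx
    have h2 := eLpNorm_le_eLpNorm_mul_rpow_measure_univ (μ := ν.withDensity N) hp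
      (f := fun y => G (x, y) / N y) (hQl x).aestronglyMeasurable
    rw [eLpNorm_one_eq_lintegral_enorm, eLpNorm_eq_lintegral_rpow_enorm_toReal hp0 hpt,
      withDensity_apply _ MeasurableSet.univ, setLIntegral_univ] at h2
    simp only [enorm_eq_self, ENNReal.toReal_one, ← hr, ← hI, div_one] at h2
    rw [h1]
    refine (ENNReal.rpow_le_rpow h2 hr0.le).trans_eq ?_
    rw [ENNReal.mul_rpow_of_nonneg _ _ hr0.le, ← ENNReal.rpow_mul, ← ENNReal.rpow_mul,
      one_div, inv_mul_cancel₀ hr0.ne', ENNReal.rpow_one, sub_mul, inv_mul_cancel₀ hr0.ne',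
      one_mul, mul_comm]
    congr 1
    rw [lintegral_withDensity_eq_lintegral_mul _ hNm ((hQl x).pow_const r)]
    rfl
  have hle : ∫⁻ x, (∫⁻ y, G (x, y) ∂ν) ^ r ∂μ ≤ I ^ r := by
    have hm2 : Measurable fun q : α × β => N q.2 * (G q / N q.2) ^ r :=
      (hNm.comp measurable_snd).mul (hQ.pow_const r)
    calc ∫⁻ x, (∫⁻ y, G (x, y) ∂ν) ^ r ∂μ
        ≤ ∫⁻ x, I ^ (r - 1) * ∫⁻ y, N y * (G (x, y) / N y) ^ r ∂ν ∂μ := lintegral_mono_ae hpt'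
      _ = I ^ (r - 1) * ∫⁻ x, ∫⁻ y, N y * (G (x, y) / N y) ^ r ∂ν ∂μ :=
          lintegral_const_mul _ hm2.lintegral_prod_right'
      _ = I ^ (r - 1) * ∫⁻ y, ∫⁻ x, N y * (G (x, y) / N y) ^ r ∂μ ∂ν := by
          rw [lintegral_lintegral_swap hm2.aemeasurable]
      _ ≤ I ^ (r - 1) * I := by
          rw [hI]
          gcongr with y
          rw [lintegral_const_mul _ ((hQr y).pow_const r)]
          refine mul_le_of_le_one_right' ?_
          simp_rw [ENNReal.div_rpow_of_nonneg _ _ hr0.le, div_eq_mul_inv]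
          rw [lintegral_mul_const _ ((hGr y).pow_const r), hNr]
          exact ENNReal.mul_inv_le_one _
      _ = I ^ r := by
          nth_rewrite 2 [← ENNReal.rpow_one I]
          rw [← ENNReal.rpow_add_of_nonneg _ _ (by linarith) zero_le_one, sub_add_cancel]
  rw [eLpNorm_eq_lintegral_rpow_enorm_toReal hp0 hpt]
  simp only [enorm_eq_self, ← hr]
  refine (ENNReal.rpow_le_rpow hle (by positivity)).trans_eq ?_
  rw [← ENNReal.rpow_mul, one_div, mul_inv_cancel₀ hr0.ne', ENNReal.rpow_one]

/-! ### Weighted mixed norms and Young's inequality -/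

namespace TimeFreq

/-- The mixed norm of a `[0, ∞]`-valued function on the time-frequency plane. -/
def emixedNorm {d : ℕ} (p q : ℝ≥0∞) (F : Phase d → ℝ≥0∞) : ℝ≥0∞ :=
  eLpNorm (fun ω : Rd d => eLpNorm (fun x : Rd d => F (x, ω)) p volume) q volume

/-- Only pointwise norms matter, so one theory of `ℝ≥0∞`-valued functions serves both the scalar
STFT and the $L^2$-valued map $z\mapsto\mathcal A_{T_zf}\psi$. -/
theorem mixedNorm_eq_emixedNorm {d : ℕ} {X : Type*} [NormedAddCommGroup X] (p q : ℝ≥0∞)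
    {m : Phase d → ℝ} (hm : ∀ z, 0 ≤ m z) (F : Phase d → X) :
    mixedNorm p q m F = emixedNorm p q (fun z => ENNReal.ofReal (m z) * ‖F z‖ₑ) := by
  unfold mixedNorm emixedNorm
  congr 1
  funext ω
  refine eLpNorm_congr_enorm_ae (ae_of_all _ fun x => ?_)
  rw [enorm_mul, enorm_norm, Real.enorm_of_nonneg (hm _), enorm_eq_self, mul_comm]

theorem emixedNorm_mono {d : ℕ} {p q : ℝ≥0∞} {F G : Phase d → ℝ≥0∞} (h : ∀ z, F z ≤ G z) :
    emixedNorm p q F ≤ emixedNorm p q G :=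
  eLpNorm_mono_enorm fun ω => eLpNorm_mono_enorm fun x => h (x, ω)

theorem eLpNorm_const_mul_le_ennreal {α : Type*} [MeasurableSpace α] {μ : Measure α} (p : ℝ≥0∞)
    {c : ℝ≥0∞} (hc : c ≠ ∞) (F : α → ℝ≥0∞) :
    eLpNorm (fun x => c * F x) p μ ≤ c * eLpNorm F p μ := by
  lift c to NNReal using hc
  rw [← smul_eq_mul, ← ENNReal.smul_def]
  refine eLpNorm_le_nnreal_smul_eLpNorm_of_ae_le_mul' (ae_of_all _ fun x => ?_) p
  rw [enorm_eq_self, enorm_eq_self]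

theorem emixedNorm_const_mul_le {d : ℕ} {p q c : ℝ≥0∞} (hc : c ≠ ∞) (F : Phase d → ℝ≥0∞) :
    emixedNorm p q (fun z => c * F z) ≤ c * emixedNorm p q F :=
  (eLpNorm_mono_enorm fun ω => eLpNorm_const_mul_le_ennreal p hc fun x => F (x, ω)).trans
    (eLpNorm_const_mul_le_ennreal q hc _)

/-- Minkowski's integral inequality for the mixed norms. -/
theorem emixedNorm_lintegral_le {d : ℕ} {β : Type*} [MeasurableSpace β] {ν : Measure β}
    [SFinite ν] {p q : ℝ≥0∞} (hp : 1 ≤ p) (hq : 1 ≤ q) {G : Phase d × β → ℝ≥0∞}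
    (hG : Measurable G) :
    emixedNorm p q (fun z => ∫⁻ y, G (z, y) ∂ν) ≤ ∫⁻ y, emixedNorm p q (fun z => G (z, y)) ∂ν := by
  have h1 : ∀ ω : Rd d, eLpNorm (fun x : Rd d => ∫⁻ y, G ((x, ω), y) ∂ν) p volume ≤
      ∫⁻ y, eLpNorm (fun x : Rd d => G ((x, ω), y)) p volume ∂ν := fun ω =>
    eLpNorm_lintegral_le (G := fun a : Rd d × β => G ((a.1, ω), a.2)) (hG.comp (by fun_prop)) hp
  have h2 : Measurable fun a : Rd d × β => eLpNorm (fun x : Rd d => G ((x, a.1), a.2)) p volume :=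
    measurable_eLpNorm_prod_left (G := fun b : Rd d × (Rd d × β) => G ((b.1, b.2.1), b.2.2))
      (hG.comp (by fun_prop)) p
  exact (eLpNorm_mono_enorm h1).trans (eLpNorm_lintegral_le h2 hq)

theorem eLpNorm_comp_add_right {G : Type*} [MeasurableSpace G] [AddGroup G] [MeasurableAdd G]
    {μ : Measure G} [μ.IsAddRightInvariant] (p : ℝ≥0∞) {g : G → ℝ≥0∞} (hg : Measurable g) (a : G) :
    eLpNorm (fun x => g (x + a)) p μ = eLpNorm g p μ :=
  eLpNorm_comp_measurePreserving hg.aestronglyMeasurable (measurePreserving_add_right μ a)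

theorem emixedNorm_comp_add_right {d : ℕ} {p q : ℝ≥0∞} {F : Phase d → ℝ≥0∞} (hF : Measurable F)
    (u : Phase d) : emixedNorm p q (fun z => F (z + u)) = emixedNorm p q F := by
  have h1 : ∀ ω : Rd d, eLpNorm (fun x : Rd d => F ((x, ω) + u)) p volume =
      eLpNorm (fun x : Rd d => F (x, ω + u.2)) p volume := fun ω =>
    eLpNorm_comp_add_right p (g := fun x : Rd d => F (x, ω + u.2))
      (hF.comp measurable_prodMk_right) u.1
  rw [emixedNorm, funext h1]
  exact eLpNorm_comp_add_right q
    (g := fun ω : Rd d => eLpNorm (fun x : Rd d => F (x, ω)) p volume)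
    (measurable_eLpNorm_prod_left hF p) u.2

/-- Young's inequality for correlations in weighted mixed norms. -/
theorem emixedNorm_correlation_le {d : ℕ} {p q : ℝ≥0∞} (hp : 1 ≤ p) (hq : 1 ≤ q)
    {M W k F : Phase d → ℝ≥0∞} (hM : Measurable M) (hW : Measurable W) (hk : Measurable k)
    (hF : Measurable F) (hkW : ∀ u, k u * W u ≠ ∞) (hMW : ∀ z u, M z ≤ W u * M (z + u)) :
    emixedNorm p q (fun z => M z * ∫⁻ u, k u * F (z + u)) ≤
      (∫⁻ u, k u * W u) * emixedNorm p q (fun z => M z * F z) := by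
  have hG : Measurable fun a : Phase d × Phase d =>
      k a.2 * W a.2 * (M (a.1 + a.2) * F (a.1 + a.2)) :=
    ((hk.comp measurable_snd).mul (hW.comp measurable_snd)).mul
      ((hM.comp (by fun_prop)).mul (hF.comp (by fun_prop)))
  -- Moderateness moves the weight inside the integral. The right side is then a superposition of
  -- translates of `M * F`, all with the same mixed norm, to which Minkowski applies.
  have h1 : ∀ z, M z * ∫⁻ u, k u * F (z + u) ≤
      ∫⁻ u, k u * W u * (M (z + u) * F (z + u)) := fun z => by
    have hm : Measurable fun u => k u * F (z + u) := hk.mul (hF.comp (measurable_const_add z))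
    rw [← lintegral_const_mul _ hm]
    refine lintegral_mono fun u => (mul_le_mul_left (hMW z u) _).trans_eq ?_
    ring
  have h2 : ∀ u, emixedNorm p q (fun z => k u * W u * (M (z + u) * F (z + u))) ≤
      k u * W u * emixedNorm p q (fun z => M z * F z) := fun u => by
    rw [← emixedNorm_comp_add_right (F := fun z => M z * F z) (hM.mul hF) u]
    exact emixedNorm_const_mul_le (hkW u) _
  refine (emixedNorm_mono h1).trans ((emixedNorm_lintegral_le hp hq hG).trans ?_)
  have hm : Measurable fun u => k u * W u := hk.mul hW
  rw [← lintegral_mul_const _ hm]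
  exact lintegral_mono h2

/-- A moderate weight is equivalent to a measurable weight that is moderate with constant `1`. -/
theorem IsModerate.exists_measurable {d : ℕ} {v : SubmultWeight d} {m : Phase d → ℝ}
    (hm : IsModerate v m) : ∃ (M : Phase d → ℝ≥0∞) (a b : ℝ), 0 < a ∧ 0 < b ∧ Measurable M ∧
      (∀ z u, M z ≤ ENNReal.ofReal (v u) * M (z + u)) ∧
      (∀ z, ENNReal.ofReal (m z) ≤ ENNReal.ofReal a * M z) ∧
      ∀ z, M z ≤ ENNReal.ofReal b * ENNReal.ofReal (m z) := by
  obtain ⟨C, hC, hmod⟩ := hm.moderate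
  have hv0 : ∀ z, 0 < v z := fun z => zero_lt_one.trans_le (v.one_le z)
  -- Take $M(z)=\sup_w m(w)/v(w-z)$. As a supremum of continuous functions it is lower
  -- semicontinuous, hence Borel, although `m` and its slices need not be. The choice $w=z$ gives
  -- $m\le v(0)M$, moderateness gives $M\le Cm$, and submultiplicativity of `v` makes `M` moderate
  -- with constant `1`.
  refine ⟨fun z => ⨆ w, ENNReal.ofReal (m w / v (w - z)), v 0, C, hv0 0, hC, ?_, ?_, ?_, ?_⟩
  · have : ∀ w, Continuous fun z => ENNReal.ofReal (m w / v (w - z)) := fun w =>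
      ENNReal.continuous_ofReal.comp (continuous_const.div (v.continuous'.comp (by fun_prop))
        fun z => (hv0 _).ne')
    exact (lowerSemicontinuous_iSup fun w => (this w).lowerSemicontinuous).measurable
  · intro z u
    refine iSup_le fun w => ?_
    refine le_trans ?_ (mul_le_mul_right
      (le_iSup (fun w => ENNReal.ofReal (m w / v (w - (z + u)))) w) _)
    rw [← ENNReal.ofReal_mul (v.nonneg' u)]
    refine ENNReal.ofReal_le_ofReal ?_
    rw [← mul_div_assoc, div_le_div_iff₀ (hv0 _) (hv0 _), mul_comm (v u), mul_assoc]
    refine mul_le_mul_of_nonneg_left ?_ (hm.nonneg w)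
    have h := v.submul' (-u) (w - z)
    have hs : v (-u) = v u := (v.symm_left' u.1 (-u.2)).trans (v.symm_right' u.1 u.2)
    rw [hs] at h
    rwa [show -u + (w - z) = w - (z + u) by abel] at h
  · intro z
    refine le_trans ?_ (mul_le_mul_right (le_iSup (fun w => ENNReal.ofReal (m w / v (w - z))) z) _)
    rw [← ENNReal.ofReal_mul (v.nonneg' _), sub_self, mul_div_cancel₀ _ (hv0 0).ne']
  · intro z
    refine iSup_le fun w => ?_
    rw [← ENNReal.ofReal_mul hC.le]
    refine ENNReal.ofReal_le_ofReal ?_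
    rw [div_le_iff₀ (hv0 _)]
    have := hmod (w - z) z
    rw [sub_add_cancel] at this
    linarith

end TimeFreq

/-! ### Plancherel and Moyal's identity -/

open FourierTransform in
/-- On `L¹ ∩ L²` the Fourier transform of `L²` is given by the Fourier integral. -/
theorem coeFn_fourier_toLp {E : Type*} [NormedAddCommGroup E] [InnerProductSpace ℝ E]
    [FiniteDimensional ℝ E] [MeasurableSpace E] [BorelSpace E] {u : E → ℂ}
    (h1 : Integrable u volume) (h2 : MemLp u 2 volume) :
    (𝓕 (h2.toLp u) : Lp ℂ 2 (volume : Measure E)) =ᵐ[volume] 𝓕 u := by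
  -- Both sides are tested against smooth compactly supported functions. The $L^2$ transform agrees
  -- with the distributional one, and $\int\hat s\,u=\int s\,\hat u$ identifies the latter with the
  -- Fourier integral.
  refine ae_eq_of_integral_contDiff_smul_eq
    ((Lp.memLp _).locallyIntegrable (by norm_num)) ?_ fun g hg hgc => ?_
  · have hc : Continuous (𝓕 u) := VectorFourier.fourierIntegral_continuous
      Real.continuous_fourierChar (L := innerₗ E) continuous_inner h1
    exact hc.locallyIntegrable
  have hgc' : HasCompactSupport fun x => (g x : ℂ) :=
    hgc.comp_left (g := fun r : ℝ => (r : ℂ)) Complex.ofReal_zero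
  set s : SchwartzMap E ℂ := hgc'.toSchwartzMap (Complex.ofRealCLM.contDiff.comp hg) with hs
  have e1 := congrArg (fun T : TemperedDistribution E ℂ => T s)
    (Lp.fourier_toTemperedDistribution_eq (h2.toLp u))
  simp only [TemperedDistribution.fourier_apply, Lp.toTemperedDistribution_apply] at e1
  have e2 : ∫ x, 𝓕 (s : E → ℂ) x • u x = ∫ x, s x • 𝓕 u x :=
    VectorFourier.integral_fourierIntegral_smul_eq_flip (L := innerₗ E)
      Real.continuous_fourierChar continuous_inner s.integrable h1 |>.trans (by simp; rfl)
  have e3 : ∫ x, (𝓕 s) x • (h2.toLp u) x = ∫ x, 𝓕 (s : E → ℂ) x • u x := by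
    refine integral_congr_ae ?_
    filter_upwards [h2.coeFn_toLp] with x hx
    rw [hx, SchwartzMap.fourier_coe]
  rw [e3, e2] at e1
  exact e1.symm

/-- The shear `(x, t) ↦ (t, t - x)` preserves the product measure. -/
theorem measurePreserving_prod_sub_swap {G : Type*} [MeasurableSpace G] [AddCommGroup G]
    [MeasurableAdd₂ G] [MeasurableNeg G] {μ : Measure G} [SFinite μ] [μ.IsAddLeftInvariant]
    [μ.IsNegInvariant] :
    MeasurePreserving (fun q : G × G => (q.2, q.2 - q.1)) (μ.prod μ) (μ.prod μ) := by
  have h : MeasurePreserving (fun q : G × G => (q.1, q.1 - q.2)) (μ.prod μ) (μ.prod μ) :=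
    MeasurePreserving.skew_product (g := fun x y => x - y) (MeasurePreserving.id μ)
      (measurable_fst.sub measurable_snd)
      (Eventually.of_forall fun x => (Measure.measurePreserving_sub_left μ x).map_eq)
  exact h.comp Measure.measurePreserving_swap

/-- The integrand is a tensor product pulled back along a measure-preserving shear. -/
theorem Integrable.mul_prod_sub {G : Type*} [MeasurableSpace G] [AddCommGroup G]
    [MeasurableAdd₂ G] [MeasurableNeg G] {μ : Measure G} [SFinite μ] [μ.IsAddLeftInvariant]
    [μ.IsNegInvariant] {L : Type*} [NormedRing L] {A B : G → L}
    (hA : Integrable A μ) (hB : Integrable B μ) :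
    Integrable (fun q : G × G => A q.2 * B (q.2 - q.1)) (μ.prod μ) :=
  measurePreserving_prod_sub_swap.integrable_comp_of_integrable (hA.mul_prod hB)

namespace TimeFreq

theorem stft_eq_integral {d : ℕ} (ξ a : L2 d) (z : Phase d) :
    stft ξ a z = ∫ t, a t * conj (character z.2 t * ξ (t - z.1)) := by
  unfold stft
  rw [L2.inner_def]
  refine integral_congr_ae ?_
  filter_upwards [coeFn_tfShift z ξ] with t h
  rw [h]; rfl

-- For fixed `x` this turns statements about the STFT in `ω` into Plancherel for a slice.
open FourierTransform in
theorem stft_eq_fourier {d : ℕ} (ξ a : L2 d) (x ω : Rd d) :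
    stft ξ a (x, ω) = 𝓕 (fun t => a t * conj (ξ (t - x))) ω := by
  rw [stft_eq_integral, Real.fourier_eq']
  refine integral_congr_ae (ae_of_all _ fun t => ?_)
  have : conj (character ω t) = Complex.exp (↑(-2 * Real.pi * inner ℝ t ω) * Complex.I) := by
    unfold character
    rw [← Complex.exp_conj, real_inner_comm]
    congr 1
    simp only [map_mul, Complex.conj_ofReal, Complex.conj_I, map_ofNat]
    push_cast
    ring
  simp only [map_mul, this, smul_eq_mul]
  ring

theorem memLp_comp_sub {d : ℕ} (ξ : L2 d) (x : Rd d) :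
    MemLp (fun t => conj (ξ (t - x))) 2 (volume : Measure (Rd d)) :=
  ((Lp.memLp ξ).comp_measurePreserving (measurePreserving_sub_right volume x)).star

theorem integrable_slice {d : ℕ} (ξ a : L2 d) (x : Rd d) :
    Integrable (fun t => a t * conj (ξ (t - x))) (volume : Measure (Rd d)) :=
  (Lp.memLp a).integrable_mul (memLp_comp_sub ξ x)

theorem integrable_sq_prod_sub {d : ℕ} (ξ a b : L2 d) :
    Integrable (fun q : Rd d × Rd d => a q.2 * conj (b q.2) * ((‖ξ (q.2 - q.1)‖ ^ 2 : ℝ) : ℂ))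
      (volume.prod volume) :=
  Integrable.mul_prod_sub ((Lp.memLp a).integrable_mul (Lp.memLp b).star)
    ((Lp.memLp ξ).integrable_norm_pow (p := 2) (by norm_num)).ofReal

/-- A product of two $L^2$ functions is only in $L^1$ in general. By Tonelli,
$\int|a(t)|^2|\xi(t-x)|^2\,dt$ is nevertheless finite for almost every `x`. -/
theorem ae_memLp_slice {d : ℕ} (ξ a : L2 d) :
    ∀ᵐ x : Rd d, MemLp (fun t => a t * conj (ξ (t - x))) 2 (volume : Measure (Rd d)) := by
  filter_upwards [(integrable_sq_prod_sub ξ a a).norm.prod_right_ae] with x hx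
  rw [memLp_two_iff_integrable_sq_norm (integrable_slice ξ a x).1]
  refine hx.congr (ae_of_all _ fun t => ?_)
  simp only [norm_mul, RCLike.norm_conj, Complex.norm_real, norm_pow, norm_norm]
  ring

/-- The Plancherel identity in the frequency variable. -/
theorem ae_integral_stft_mul_conj {d : ℕ} (ξ a b : L2 d) :
    ∀ᵐ x : Rd d, Integrable (fun ω => stft ξ a (x, ω) * conj (stft ξ b (x, ω))) volume ∧
      ∫ ω, stft ξ a (x, ω) * conj (stft ξ b (x, ω)) =
        ∫ t, a t * conj (b t) * ((‖ξ (t - x)‖ ^ 2 : ℝ) : ℂ) := by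
  filter_upwards [ae_memLp_slice ξ a, ae_memLp_slice ξ b] with x ha hb
  have e1 := coeFn_fourier_toLp (integrable_slice ξ a x) ha
  have e2 := coeFn_fourier_toLp (integrable_slice ξ b x) hb
  have e3 : (fun ω => stft ξ a (x, ω) * conj (stft ξ b (x, ω))) =ᵐ[volume] fun ω =>
      inner ℂ ((FourierTransform.fourier (hb.toLp _) : L2 d) ω)
        ((FourierTransform.fourier (ha.toLp _) : L2 d) ω) := by
    filter_upwards [e1, e2] with ω h1 h2
    rw [h1, h2, stft_eq_fourier, stft_eq_fourier]
    rfl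
  refine ⟨(L2.integrable_inner _ _).congr e3.symm, ?_⟩
  rw [integral_congr_ae e3, ← L2.inner_def, Lp.inner_fourier_eq, L2.inner_def]
  refine integral_congr_ae ?_
  filter_upwards [ha.coeFn_toLp, hb.coeFn_toLp] with t h1 h2
  rw [h1, h2, RCLike.inner_apply, map_mul, Complex.conj_conj]
  push_cast
  rw [← Complex.mul_conj']
  ring

/-- Plancherel on almost every slice, then integrability of the slice norms in `x`. This square
integrability is what justifies Fubini in Moyal's identity. -/
theorem memLp_stft {d : ℕ} (ξ a : L2 d) :
    MemLp (stft ξ a) 2 (volume : Measure (Phase d)) := by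
  have hc : Continuous fun z => ‖stft ξ a z‖ ^ 2 := (continuous_stft ξ a).norm.pow 2
  rw [memLp_two_iff_integrable_sq_norm (continuous_stft ξ a).aestronglyMeasurable,
    Measure.volume_eq_prod, integrable_prod_iff hc.aestronglyMeasurable]
  have h := ae_integral_stft_mul_conj ξ a a
  have e : ∀ c : ℂ, c * conj c = ((‖c‖ ^ 2 : ℝ) : ℂ) := fun c => by
    rw [Complex.mul_conj']; push_cast; rfl
  simp only [e] at h
  refine ⟨?_, ?_⟩
  · filter_upwards [h] with x hx
    exact hx.1.re.congr (ae_of_all _ fun ω => Complex.ofReal_re _)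
  · refine ((integrable_sq_prod_sub ξ a a).integral_prod_left).re.congr ?_
    filter_upwards [h] with x hx
    have h2 := hx.2
    rw [integral_complex_ofReal] at h2
    simp only [e, norm_pow, norm_norm]
    rw [← h2]
    exact Complex.ofReal_re _

/-- **Moyal's identity** (orthogonality relations) for a single window. -/
theorem integral_stft_mul_conj {d : ℕ} (ξ a b : L2 d) :
    ∫ z, stft ξ a z * conj (stft ξ b z) = inner ℂ b a * (‖ξ‖ ^ 2 : ℝ) := by
  have hi : Integrable (fun z => stft ξ a z * conj (stft ξ b z)) (volume : Measure (Phase d)) :=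
    (memLp_stft ξ a).integrable_mul (memLp_stft ξ b).star
  rw [Measure.volume_eq_prod] at hi ⊢
  rw [integral_prod _ hi,
    integral_congr_ae ((ae_integral_stft_mul_conj ξ a b).mono fun x hx => hx.2),
    integral_integral_swap (integrable_sq_prod_sub ξ a b)]
  -- With the `x`-integral innermost, reflection and translation invariance reduce it to
  -- $\|\xi\|^2$, independently of `t`.
  have h1 : ∀ t : Rd d, ∫ x, a t * conj (b t) * ((‖ξ (t - x)‖ ^ 2 : ℝ) : ℂ) =
      a t * conj (b t) * (‖ξ‖ ^ 2 : ℝ) := fun t => by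
    rw [integral_const_mul, integral_sub_left_eq_self (fun s => ((‖ξ s‖ ^ 2 : ℝ) : ℂ)) volume t]
    refine congrArg (a t * conj (b t) * ·) ?_
    rw [integral_complex_ofReal]
    refine congrArg Complex.ofReal ?_
    have h := L2.inner_def (𝕜 := ℂ) ξ ξ
    rw [inner_self_eq_norm_sq_to_K] at h
    have h3 : ∀ s, inner ℂ (ξ s) (ξ s) = ((‖ξ s‖ ^ 2 : ℝ) : ℂ) := fun s => by
      rw [inner_self_eq_norm_sq_to_K]; norm_cast
    simp only [h3] at h
    rw [integral_complex_ofReal] at h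
    refine Complex.ofReal_injective (h.symm.trans ?_)
    push_cast
    rfl
  simp_rw [h1]
  rw [integral_mul_const, L2.inner_def]
  rfl

end TimeFreq

/-! ### Integral representation of functionals on $L^1$ and on $M^1_v$ -/

/-- A linear functional dominated by the norm of `T` factors through `T`. -/
theorem LinearMap.exists_clm_comp_eq {𝕜 E L : Type*} [RCLike 𝕜] [AddCommGroup E] [Module 𝕜 E]
    [NormedAddCommGroup L] [NormedSpace 𝕜 L] (T : E →ₗ[𝕜] L) (f : E →ₗ[𝕜] 𝕜) {C : ℝ}
    (h : ∀ x, ‖f x‖ ≤ C * ‖T x‖) : ∃ ℓ : L →L[𝕜] 𝕜, ∀ x, ℓ (T x) = f x := by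
  -- The bound forces `f` to vanish on the kernel of `T`, so `f` descends to a bounded functional on
  -- the range of `T`; Hahn–Banach extends it to all of `L`.
  have hf : f ∈ LinearMap.range T.dualMap := by
    rw [LinearMap.range_dualMap_eq_dualAnnihilator_ker, Submodule.mem_dualAnnihilator]
    intro x hx
    have := h x
    rw [LinearMap.mem_ker.1 hx, norm_zero, mul_zero] at this
    exact norm_le_zero_iff.1 this
  obtain ⟨g, hg⟩ := hf
  have hg' : ∀ x, g (T x) = f x := fun x => by rw [← hg]; rfl
  let g₀ : LinearMap.range T →L[𝕜] 𝕜 := (g.comp (LinearMap.range T).subtype).mkContinuous C (by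
    rintro ⟨_, x, rfl⟩
    simpa [hg'] using h x)
  obtain ⟨ℓ, hℓ, -⟩ := exists_extension_norm_eq (LinearMap.range T) g₀
  refine ⟨ℓ, fun x => ?_⟩
  rw [← hg' x]
  exact hℓ ⟨T x, x, rfl⟩

/-- Bounded functionals on `L¹` of a finite measure are given by bounded functions. -/
theorem exists_bounded_density_of_isFiniteMeasure {α : Type*} [MeasurableSpace α] {ν : Measure α}
    [IsFiniteMeasure ν] (ℓ : Lp ℂ 1 ν →L[ℂ] ℂ) :
    ∃ h : α → ℂ, StronglyMeasurable h ∧ (∀ x, ‖h x‖ ≤ ‖ℓ‖) ∧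
      ∀ g : Lp ℂ 1 ν, ℓ g = ∫ x, h x * g x ∂ν := by
  -- Since `ν` is finite, $L^2\subset L^1$ continuously. Restricting `ℓ` to $L^2$ and applying Riesz
  -- produces the candidate density `conj k`.
  have h21 : ∀ g : Lp ℂ 2 ν, MemLp g 1 ν := fun g => (Lp.memLp g).mono_exponent (by norm_num)
  let J : Lp ℂ 2 ν →ₗ[ℂ] Lp ℂ 1 ν :=
    { toFun := fun g => (h21 g).toLp
      map_add' := fun g g' => by
        rw [← MemLp.toLp_add]
        exact MemLp.toLp_congr _ _ (Lp.coeFn_add g g')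
      map_smul' := fun c g => by
        rw [RingHom.id_apply, ← MemLp.toLp_const_smul]
        exact MemLp.toLp_congr _ _ (Lp.coeFn_smul c g) }
  have hJ : ∀ g, J g =ᵐ[ν] g := fun g => (h21 g).coeFn_toLp
  let A : Lp ℂ 2 ν →L[ℂ] ℂ := (ℓ.toLinearMap.comp J).mkContinuous
    (‖ℓ‖ * (ν Set.univ ^ (1 / 2 : ℝ)).toReal) (by
      intro g
      refine (ℓ.le_opNorm (J g)).trans ?_
      rw [mul_assoc]
      gcongr
      have hJn : ‖J g‖ = (eLpNorm g 1 ν).toReal := Lp.norm_toLp _ (h21 g)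
      rw [hJn, Lp.norm_def, mul_comm, ← ENNReal.toReal_mul]
      refine ENNReal.toReal_mono (ENNReal.mul_ne_top (Lp.memLp g).eLpNorm_ne_top (by simp)) ?_
      refine (eLpNorm_le_eLpNorm_mul_rpow_measure_univ (p := 1) (q := 2) (by norm_num)
        (Lp.memLp g).1).trans_eq ?_
      norm_num)
  set k : Lp ℂ 2 ν := (InnerProductSpace.toDual ℂ (Lp ℂ 2 ν)).symm A with hk
  have hA : ∀ g : Lp ℂ 2 ν, ℓ (J g) = ∫ x, conj (k x) * g x ∂ν := fun g => by
    have : inner ℂ k g = A g := InnerProductSpace.toDual_symm_apply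
    rw [L2.inner_def] at this
    exact this.symm.trans (integral_congr_ae (ae_of_all _ fun x => mul_comm _ _))
  have hkm : StronglyMeasurable fun x => conj (k x) := (Lp.stronglyMeasurable k).star
  have hbd : ∀ᵐ x ∂ν, ‖conj (k x)‖ ≤ ‖ℓ‖ := by
    refine ae_le_of_forall_setIntegral_le ((h21 k).star.integrable le_rfl).norm
      (integrable_const _) fun s hs _ => ?_
    -- Testing `ℓ` on the phase of `k` over `s` yields $\int_s|k|\le\|\ell\|\,\nu(s)$ for every `s`.
    -- Where `k` vanishes the quotient is `0`, so $|g|\le1$ still holds.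
    set g : α → ℂ := s.indicator fun x => k x / ‖k x‖ with hg
    have hgm : StronglyMeasurable g :=
      ((Lp.stronglyMeasurable k).div
        (Complex.continuous_ofReal.comp_stronglyMeasurable
          (Lp.stronglyMeasurable k).norm)).indicator hs
    have hg1 : ∀ x, ‖g x‖ ≤ s.indicator (fun _ => (1 : ℝ)) x := fun x => by
      rw [hg, norm_indicator_eq_indicator_norm]
      refine Set.indicator_le_indicator ?_
      rw [norm_div, Complex.norm_real, norm_norm]
      exact div_self_le_one _
    have hgL : MemLp g 2 ν := MemLp.of_bound hgm.aestronglyMeasurable 1 (ae_of_all _ fun x =>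
      (hg1 x).trans (Set.indicator_le_self' (fun _ _ => zero_le_one) x))
    have e1 : ℓ (J (hgL.toLp g)) = ((∫ x in s, ‖conj (k x)‖ ∂ν : ℝ) : ℂ) := by
      rw [hA, ← integral_indicator hs, ← integral_complex_ofReal]
      refine integral_congr_ae ?_
      filter_upwards [hgL.coeFn_toLp] with x hx
      rw [hx, hg]
      by_cases hxs : x ∈ s
      · simp only [Set.indicator_of_mem hxs, RCLike.norm_conj]
        rcases eq_or_ne (k x) 0 with h0 | h0
        · simp [h0]
        · have : (‖k x‖ : ℂ) ≠ 0 := by exact_mod_cast norm_ne_zero_iff.2 h0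
          rw [← mul_div_assoc, Complex.conj_mul', div_eq_iff this, sq]
      · simp [Set.indicator_of_notMem hxs]
    have e2 : ‖J (hgL.toLp g)‖ ≤ ∫ x in s, (1 : ℝ) ∂ν := by
      rw [L1.norm_eq_integral_norm, ← integral_indicator hs]
      refine integral_mono_ae (L1.integrable_coeFn _).norm ((integrable_const _).indicator hs) ?_
      filter_upwards [hJ (hgL.toLp g), hgL.coeFn_toLp] with x h1 h2
      rw [h1, h2]
      exact hg1 x
    have e3 := ℓ.le_opNorm (J (hgL.toLp g))
    rw [e1, Complex.norm_real] at e3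
    refine (Real.le_norm_self _).trans (e3.trans ?_)
    refine (mul_le_mul_of_nonneg_left e2 (norm_nonneg _)).trans_eq ?_
    rw [← integral_const_mul, mul_one]
  -- Discarding a null set makes the bound hold everywhere, not just almost everywhere.
  set S : Set α := {x | ‖conj (k x)‖ ≤ ‖ℓ‖} with hS
  have hSm : MeasurableSet S := hkm.norm.measurable measurableSet_Iic
  set h : α → ℂ := S.indicator fun x => conj (k x) with hh
  have hhm : StronglyMeasurable h := hkm.indicator hSm
  have hhk : h =ᵐ[ν] fun x => conj (k x) := by
    filter_upwards [hbd] with x hx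
    exact Set.indicator_of_mem (s := S) hx _
  have hhb : ∀ x, ‖h x‖ ≤ ‖ℓ‖ := fun x => by
    by_cases hx : x ∈ S
    · rw [hh, Set.indicator_of_mem hx]; exact hx
    · rw [hh, Set.indicator_of_notMem hx, norm_zero]; exact norm_nonneg _
  have hint : ∀ g : Lp ℂ 1 ν, Integrable (fun x => h x * g x) ν := fun g =>
    (L1.integrable_coeFn g).bdd_mul hhm.aestronglyMeasurable (ae_of_all _ hhb)
  refine ⟨h, hhm, hhb, fun g => ?_⟩
  let B : Lp ℂ 1 ν →L[ℂ] ℂ := LinearMap.mkContinuous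
    { toFun := fun g => ∫ x, h x * g x ∂ν
      map_add' := fun g g' => by
        rw [← integral_add (hint g) (hint g')]
        refine integral_congr_ae ?_
        filter_upwards [Lp.coeFn_add g g'] with x hx
        rw [hx, Pi.add_apply, mul_add]
      map_smul' := fun c g => by
        rw [RingHom.id_apply, smul_eq_mul, ← integral_const_mul]
        refine integral_congr_ae ?_
        filter_upwards [Lp.coeFn_smul c g] with x hx
        rw [hx, Pi.smul_apply, smul_eq_mul]
        ring } ‖ℓ‖ (by
      intro g
      rw [L1.norm_eq_integral_norm, ← integral_const_mul]
      refine norm_integral_le_of_norm_le ((L1.integrable_coeFn g).norm.const_mul _)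
        (ae_of_all _ fun x => ?_)
      rw [norm_mul]
      gcongr
      exact hhb x)
  suffices ℓ = B from congrArg (fun T : Lp ℂ 1 ν →L[ℂ] ℂ => T g) this
  refine ContinuousLinearMap.ext fun g => ?_
  refine Lp.induction ENNReal.one_ne_top (motive := fun g => ℓ g = B g) ?_ ?_ ?_ g
  · intro c s hs hμs
    have e : (Lp.simpleFunc.indicatorConst 1 hs hμs.ne c : Lp ℂ 1 ν) =
        J (indicatorConstLp 2 hs hμs.ne c) := by
      rw [Lp.simpleFunc.coe_indicatorConst]
      ext1
      filter_upwards [hJ (indicatorConstLp 2 hs hμs.ne c),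
        indicatorConstLp_coeFn (p := 1) (hs := hs) (hμs := hμs.ne) (c := c),
        indicatorConstLp_coeFn (p := 2) (hs := hs) (hμs := hμs.ne) (c := c)] with x h1 h2 h3
      rw [h1, h2, h3]
    rw [e, hA]
    refine integral_congr_ae ?_
    filter_upwards [hJ (indicatorConstLp 2 hs hμs.ne c), hhk] with x h1 h2
    rw [h1, h2]
  · intro f g hf hg _ h1 h2
    rw [map_add, map_add, h1, h2]
  · exact isClosed_eq ℓ.continuous B.continuous

/-- Bounded functionals on `L¹` of a σ-finite measure are given by bounded functions. -/
theorem exists_bounded_density {α : Type*} [MeasurableSpace α] {μ : Measure α}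
    [SigmaFinite μ] (ℓ : Lp ℂ 1 μ →L[ℂ] ℂ) :
    ∃ h : α → ℂ, ∃ K : ℝ, StronglyMeasurable h ∧ (∀ x, ‖h x‖ ≤ K) ∧
      ∀ g : Lp ℂ 1 μ, ℓ g = ∫ x, h x * g x ∂μ := by
  -- A strictly positive integrable density `ρ` gives a finite measure `ν`. Multiplication by `ρ`
  -- maps $L^1(\nu)$ isometrically onto $L^1(\mu)$, with inverse division by `ρ`, so the density
  -- found for `ν` also serves for `μ`.
  obtain ⟨ρ, hρ0, hρm, hρ1⟩ := exists_pos_lintegral_lt_of_sigmaFinite μ (ε := 1) (by simp)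
  set ν := μ.withDensity fun x => (ρ x : ℝ≥0∞) with hν
  have : IsFiniteMeasure ν := isFiniteMeasure_withDensity (hρ1.trans (by simp)).ne
  have hac : μ ≪ ν := withDensity_absolutelyContinuous' (by fun_prop)
    (ae_of_all _ fun x => by exact_mod_cast (hρ0 x).ne')
  have hsm : ∀ g : Lp ℂ 1 ν, MemLp (fun x => ρ x • g x) 1 μ := fun g => by
    rw [memLp_one_iff_integrable]
    exact (integrable_withDensity_iff_integrable_smul hρm).1 (L1.integrable_coeFn g)
  let J : Lp ℂ 1 ν →ₗ[ℂ] Lp ℂ 1 μ :=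
    { toFun := fun g => (hsm g).toLp
      map_add' := fun g g' => by
        rw [← MemLp.toLp_add]
        refine MemLp.toLp_congr _ _ ?_
        filter_upwards [hac (Lp.coeFn_add g g')] with x hx
        simp only [Pi.add_apply] at hx ⊢
        rw [hx, smul_add]
      map_smul' := fun c g => by
        rw [RingHom.id_apply, ← MemLp.toLp_const_smul]
        refine MemLp.toLp_congr _ _ ?_
        filter_upwards [hac (Lp.coeFn_smul c g)] with x hx
        simp only [Pi.smul_apply] at hx ⊢
        rw [hx, smul_comm] }
  have hJn : ∀ g, ‖J g‖ ≤ 1 * ‖g‖ := fun g => by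
    rw [one_mul, L1.norm_eq_integral_norm, L1.norm_eq_integral_norm,
      integral_withDensity_eq_integral_smul hρm]
    refine (integral_congr_ae ?_).le
    filter_upwards [(hsm g).coeFn_toLp] with x hx
    change ‖(hsm g).toLp _ x‖ = _
    rw [hx, NNReal.smul_def, NNReal.smul_def, norm_smul, Real.norm_of_nonneg (NNReal.coe_nonneg _),
      smul_eq_mul]
  obtain ⟨h, hm, hb, hrep⟩ :=
    exists_bounded_density_of_isFiniteMeasure (ℓ.comp (J.mkContinuous 1 hJn))
  refine ⟨h, _, hm, hb, fun g => ?_⟩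
  have hgi : Integrable (fun x => (ρ x)⁻¹ • g x) ν := by
    rw [integrable_withDensity_iff_integrable_smul hρm]
    refine (L1.integrable_coeFn g).congr (ae_of_all _ fun x => ?_)
    simp only
    rw [smul_smul, mul_inv_cancel₀ (hρ0 x).ne', one_smul]
  have hgJ : J (hgi.toL1 _) = g := by
    ext1
    filter_upwards [(hsm (hgi.toL1 _)).coeFn_toLp, hac hgi.coeFn_toL1] with x h1 h2
    change (hsm (hgi.toL1 _)).toLp _ x = _
    rw [h1, h2, smul_smul, mul_inv_cancel₀ (hρ0 x).ne', one_smul]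
  have h1 := hrep (hgi.toL1 _)
  rw [ContinuousLinearMap.comp_apply, LinearMap.mkContinuous_apply, hgJ] at h1
  rw [h1, integral_withDensity_eq_integral_smul hρm]
  refine integral_congr_ae ?_
  filter_upwards [hac hgi.coeFn_toL1] with x hx
  rw [hx, mul_smul_comm, smul_smul, mul_inv_cancel₀ (hρ0 x).ne', one_smul]

namespace TimeFreq

/-- The duality bracket is an absolutely convergent integral on the time-frequency plane. -/
theorem M1Dual.exists_density {d : ℕ} {v : SubmultWeight d} (ψ : M1Dual v) :
    ∃ H : Phase d → ℂ, ∃ K : ℝ, StronglyMeasurable H ∧ (∀ z, ‖H z‖ ≤ K * v z) ∧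
      ∀ φ : M1 v, ψ.bracket φ = ∫ z, H z * conj (TimeFreq.stft (gaussian d) (φ : L2 d) z) := by
  have hi : ∀ φ : M1 v, Integrable (fun z => TimeFreq.stft (gaussian d) (φ : L2 d) z * (v z : ℂ))
      volume := fun φ => by
    refine (mem_M1.1 φ.2).mono' ((continuous_stft _ _).mul
      (Complex.continuous_ofReal.comp v.continuous')).aestronglyMeasurable (ae_of_all _ fun z => ?_)
    rw [norm_mul, Complex.norm_real, Real.norm_of_nonneg (v.nonneg' z)]
  -- $\varphi\mapsto v\,V_{\varphi_0}\varphi$ embeds $M^1_v$ isometrically in $L^1$. The conjugated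
  -- bracket is linear and bounded by this norm, so it factors through `T` and has a bounded
  -- density.
  let T : M1 v →ₗ[ℂ] Lp ℂ 1 (volume : Measure (Phase d)) :=
    { toFun := fun φ => (hi φ).toL1
      map_add' := fun φ χ => by
        rw [← Integrable.toL1_add]
        congr 1
        funext z
        simp [TimeFreq.stft, inner_add_right, add_mul]
      map_smul' := fun c φ => by
        rw [RingHom.id_apply, ← Integrable.toL1_smul]
        congr 1
        funext z
        simp [TimeFreq.stft, inner_smul_right, mul_assoc] }
  have hT : ∀ φ, ‖T φ‖ = m1Norm v φ := fun φ => by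
    rw [L1.norm_eq_integral_norm]
    refine integral_congr_ae ?_
    filter_upwards [(hi φ).coeFn_toL1] with z hz
    change ‖(hi φ).toL1 _ z‖ = _
    rw [hz, norm_mul, Complex.norm_real, Real.norm_of_nonneg (v.nonneg' z)]
  let f : M1 v →ₗ[ℂ] ℂ :=
    { toFun := fun φ => conj (ψ.bracket φ)
      map_add' := fun φ χ => by rw [map_add, map_add]
      map_smul' := fun c φ => by simp }
  obtain ⟨C, hC⟩ := ψ.bounded'
  obtain ⟨ℓ, hℓ⟩ := LinearMap.exists_clm_comp_eq T f (C := C) fun φ => by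
    rw [hT]
    exact (RCLike.norm_conj _).trans_le (hC φ)
  obtain ⟨h, K, hm, hb, hrep⟩ := exists_bounded_density ℓ
  refine ⟨fun z => conj (h z) * v z, K, hm.star.mul
    (Complex.continuous_ofReal.comp v.continuous').stronglyMeasurable, fun z => ?_, fun φ => ?_⟩
  · rw [norm_mul, RCLike.norm_conj, Complex.norm_real, Real.norm_of_nonneg (v.nonneg' z)]
    exact mul_le_mul_of_nonneg_right (hb z) (v.nonneg' z)
  · have e1 : conj (ψ.bracket φ) = ∫ z, h z * T φ z := (hℓ φ).symm.trans (hrep (T φ))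
    rw [← Complex.conj_conj (ψ.bracket φ), e1, ← integral_conj]
    refine integral_congr_ae ?_
    filter_upwards [(hi φ).coeFn_toL1] with z hz
    change conj (h z * (hi φ).toL1 _ z) = _
    rw [hz, map_mul, map_mul, Complex.conj_ofReal]
    ring

end TimeFreq

theorem Integrable.mul_prod_sub_left {G : Type*} [MeasurableSpace G] [AddCommGroup G]
    [MeasurableAdd₂ G] [MeasurableNeg G] {μ : Measure G} [SFinite μ] [μ.IsAddRightInvariant]
    {L : Type*} [NormedRing L] {A B : G → L} (hA : Integrable A μ) (hB : Integrable B μ) :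
    Integrable (fun q : G × G => A q.1 * B (q.2 - q.1)) (μ.prod μ) := by
  have h : MeasurePreserving (fun q : G × G => (q.1, q.2 - q.1)) (μ.prod μ) (μ.prod μ) :=
    MeasurePreserving.skew_product (g := fun x y => y - x) (MeasurePreserving.id μ)
      (measurable_snd.sub measurable_fst)
      (Eventually.of_forall fun x => (measurePreserving_sub_right μ x).map_eq)
  exact h.integrable_comp_of_integrable (hA.mul_prod hB)

namespace TimeFreq

variable {d : ℕ} {v : SubmultWeight d}

instance isAddHaarMeasure_volume_phase (d : ℕ) :
    (volume : Measure (Phase d)).IsAddHaarMeasure := by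
  rw [Measure.volume_eq_prod]; infer_instance

instance isNegInvariant_volume_phase (d : ℕ) : (volume : Measure (Phase d)).IsNegInvariant :=
  Measure.IsAddHaarMeasure.isNegInvariant_of_regular _

/-! ### Composition of time-frequency shifts -/

theorem character_add_left (a b t : Rd d) :
    character (a + b) t = character a t * character b t := by
  unfold character
  rw [← Complex.exp_add, inner_add_left]
  congr 1
  push_cast
  ring

theorem character_sub_right (a s t : Rd d) :
    character a s = character a t * character a (s - t) := by
  unfold character
  rw [← Complex.exp_add, inner_sub_right]
  congr 1
  push_cast
  ring

theorem conj_character_mul_self (a t : Rd d) : conj (character a t) * character a t = 1 := by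
  rw [Complex.conj_mul', norm_character]; norm_num

/-- The composition law of the time-frequency shifts. -/
theorem tfShift_add (z u : Phase d) (ψ : L2 d) :
    tfShift (z + u) ψ = character u.2 z.1 • tfShift z (tfShift u ψ) := by
  ext1
  filter_upwards [coeFn_tfShift (z + u) ψ, coeFn_tfShift z (tfShift u ψ),
    sub_ae z.1 (coeFn_tfShift u ψ),
    Lp.coeFn_smul (character u.2 z.1) (tfShift z (tfShift u ψ))] with t h1 h2 h3 h4
  rw [h1, h4, Pi.smul_apply, h2, h3, smul_eq_mul, Prod.snd_add, Prod.fst_add, character_add_left,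
    sub_add_eq_sub_sub, character_sub_right u.2 t z.1]
  ring

theorem tfShift_zero (ψ : L2 d) : tfShift 0 ψ = ψ := by
  ext1
  filter_upwards [coeFn_tfShift 0 ψ] with t h
  rw [h]; simp [character]

theorem tfShift_smul (z : Phase d) (c : ℂ) (ψ : L2 d) : tfShift z (c • ψ) = c • tfShift z ψ := by
  ext1
  filter_upwards [coeFn_tfShift z (c • ψ), coeFn_tfShift z ψ, sub_ae z.1 (Lp.coeFn_smul c ψ),
    Lp.coeFn_smul c (tfShift z ψ)] with t h1 h2 h3 h4
  rw [h1, h4, h3, Pi.smul_apply, Pi.smul_apply, h2, smul_eq_mul, smul_eq_mul]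
  ring

theorem tfShift_surjective (z : Phase d) : Function.Surjective (tfShift (d := d) z) := fun ψ => by
  refine ⟨character (-z).2 z.1 • tfShift (-z) ψ, ?_⟩
  rw [tfShift_smul, ← tfShift_add, add_neg_cancel, tfShift_zero]

theorem inner_tfShift_tfShift (z : Phase d) (ψ χ : L2 d) :
    inner ℂ (tfShift z ψ) (tfShift z χ) = inner ℂ ψ χ := by
  rw [L2.inner_def, L2.inner_def,
    ← integral_sub_right_eq_self (fun t => inner ℂ (ψ t) (χ t)) z.1]
  refine integral_congr_ae ?_
  filter_upwards [coeFn_tfShift z ψ, coeFn_tfShift z χ] with t h1 h2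
  rw [h1, h2, RCLike.inner_apply, RCLike.inner_apply, map_mul]
  linear_combination (χ (t - z.1) * conj (ψ (t - z.1))) * conj_character_mul_self z.2 t

/-! ### Weights and windows -/

theorem SubmultWeight.le_mul_sub (v : SubmultWeight d) (u w : Phase d) :
    v u ≤ v w * v (u - w) := by
  simpa using v.submul' w (u - w)

theorem SubmultWeight.neg (v : SubmultWeight d) (z : Phase d) : v (-z) = v z :=
  (v.symm_left' z.1 (-z.2)).trans (v.symm_right' z.1 z.2)

/-- Moving the shift to the other entry of the inner product exchanges window and function, up to a
phase. -/
theorem norm_stft_neg (ξ a : L2 d) (z : Phase d) : ‖stft ξ a (-z)‖ = ‖stft a ξ z‖ := by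
  have h := norm_stft_tfShift ξ a 0 z
  rw [zero_sub] at h
  rw [← h]
  unfold stft
  rw [tfShift_zero, norm_inner_symm]

theorem gaussian_ne_zero (d : ℕ) : gaussian d ≠ 0 := by
  intro h
  have h1 : (fun t : Rd d => (((2 : ℝ) ^ ((d : ℝ) / 4) * Real.exp (-Real.pi * ‖t‖ ^ 2) : ℝ) : ℂ))
      =ᵐ[volume] (0 : Rd d → ℂ) :=
    (memLp_gaussian d).coeFn_toLp.symm.trans (by
      change gaussian d =ᵐ[volume] _
      rw [h]; exact Lp.coeFn_zero ℂ 2 volume)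
  obtain ⟨t, ht⟩ := h1.exists
  have : (0 : ℝ) < (2 : ℝ) ^ ((d : ℝ) / 4) * Real.exp (-Real.pi * ‖t‖ ^ 2) := by positivity
  exact this.ne' (Complex.ofReal_injective (by simpa using ht))

theorem continuous_inner_tfShift (ξ a : L2 d) :
    Continuous fun q : Phase d × Phase d => inner ℂ (tfShift q.1 ξ) (tfShift q.2 a) :=
  ((continuous_tfShift ξ).comp continuous_fst).inner ((continuous_tfShift a).comp continuous_snd)

/-- The space `M¹_v` can be described with any window in it. -/
theorem integrable_stft_mul_weight (ξ a : M1 v) :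
    Integrable (fun z => ‖stft (ξ : L2 d) (a : L2 d) z‖ * v z) volume := by
  have hp := Integrable.mul_prod_sub (mem_M1.1 a.2) (mem_M1.1 ξ.2)
  have hg : 0 < ‖gaussian d‖ ^ 2 := by have := norm_pos_iff.2 (gaussian_ne_zero d); positivity
  refine (hp.integral_prod_left.const_mul (‖gaussian d‖ ^ 2)⁻¹).mono'
    ((continuous_stft _ _).norm.mul v.continuous').aestronglyMeasurable ?_
  filter_upwards [hp.prod_right_ae] with w hw
  rw [Real.norm_of_nonneg (mul_nonneg (norm_nonneg _) (v.nonneg' w)), le_inv_mul_iff₀ hg]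
  -- Moyal with the Gaussian window expresses $\|\varphi_0\|^2V_\xi a(w)$ as an integral of
  -- $V_{\varphi_0}a(u)$ against $V_{\varphi_0}(\pi(w)\xi)(u)$. The weight splits as $v(w)\le
  -- v(u)\,v(u-w)$, leaving a correlation of two integrable functions.
  have h1 := integral_stft_mul_conj (gaussian d) (a : L2 d) (tfShift w (ξ : L2 d))
  have h2 : ‖gaussian d‖ ^ 2 * (‖stft (ξ : L2 d) (a : L2 d) w‖ * v w) =
      ‖(∫ z, stft (gaussian d) (a : L2 d) z * conj (stft (gaussian d) (tfShift w (ξ : L2 d)) z)) *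
        (v w : ℂ)‖ := by
    rw [h1, norm_mul, norm_mul, Complex.norm_real, Complex.norm_real,
      Real.norm_of_nonneg (v.nonneg' w), Real.norm_of_nonneg hg.le]
    unfold stft
    ring
  rw [h2, ← integral_mul_const]
  refine norm_integral_le_of_norm_le hw (ae_of_all _ fun u => ?_)
  rw [norm_mul, norm_mul, RCLike.norm_conj, norm_stft_tfShift, Complex.norm_real,
    Real.norm_of_nonneg (v.nonneg' w)]
  have h3 := v.le_mul_sub w u
  rw [← v.neg (w - u), neg_sub] at h3
  calc ‖stft (gaussian d) (a : L2 d) u‖ * ‖stft (gaussian d) (ξ : L2 d) (u - w)‖ * v w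
      ≤ ‖stft (gaussian d) (a : L2 d) u‖ * ‖stft (gaussian d) (ξ : L2 d) (u - w)‖ *
        (v u * v (u - w)) := by gcongr
    _ = _ := by ring

/-! ### The short-time Fourier transform on `(M¹_v)'` -/

/-- By `M1Dual.exists_density` the STFT is a parameter integral of a jointly measurable function. -/
theorem M1Dual.stronglyMeasurable_stft (φ : M1 v) (ψ : M1Dual v) :
    StronglyMeasurable (M1Dual.stft φ ψ) := by
  obtain ⟨H, K, hH, -, hrep⟩ := ψ.exists_density
  have : M1Dual.stft φ ψ = fun z => ∫ u, H u *
      conj (inner ℂ (tfShift u (gaussian d)) (tfShift z (φ : L2 d))) :=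
    funext fun z => hrep (m1Shift v z φ)
  rw [this]
  have hc := ((continuous_inner_tfShift (gaussian d) (φ : L2 d)).comp continuous_swap).star
  exact StronglyMeasurable.integral_prod_right
    ((hH.comp_measurable measurable_snd).mul hc.stronglyMeasurable)

/-- Growth at most like `v` is what lets $f\in L^1_v$ be integrated against $V_\varphi\psi$. -/
theorem M1Dual.exists_norm_stft_le (φ : M1 v) (ψ : M1Dual v) :
    ∃ K : ℝ, ∀ z, ‖M1Dual.stft φ ψ z‖ ≤ K * v z := by
  obtain ⟨H, K, hH, hK, hrep⟩ := ψ.exists_density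
  have hK0 : 0 ≤ K := nonneg_of_mul_nonneg_left ((norm_nonneg _).trans (hK 0))
    (zero_lt_one.trans_le (v.one_le 0))
  refine ⟨K * m1Norm v φ, fun z => ?_⟩
  have hi := ((mem_M1.1 φ.2).comp_sub_right z).const_mul (K * v z)
  have e : ψ.stft φ z = _ := hrep (m1Shift v z φ)
  rw [e]
  refine (norm_integral_le_of_norm_le hi (ae_of_all _ fun u => ?_)).trans_eq ?_
  · rw [norm_mul, RCLike.norm_conj]
    change ‖H u‖ * ‖TimeFreq.stft (gaussian d) (tfShift z (φ : L2 d)) u‖ ≤ _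
    rw [norm_stft_tfShift]
    calc ‖H u‖ * ‖TimeFreq.stft (gaussian d) (φ : L2 d) (u - z)‖
        ≤ (K * (v z * v (u - z))) * ‖TimeFreq.stft (gaussian d) (φ : L2 d) (u - z)‖ := by
          gcongr
          exact (hK u).trans (mul_le_mul_of_nonneg_left (v.le_mul_sub u z) hK0)
      _ = _ := by ring
  · rw [integral_const_mul, integral_sub_right_eq_self
      (fun u => ‖TimeFreq.stft (gaussian d) (φ : L2 d) u‖ * v u) z]
    unfold m1Norm
    ring

/-- Change of window: `‖ξ‖² ⟨ψ, g⟩ = ∫ conj (V_ξ g(w)) V_ξ ψ(w) dw`. -/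
theorem M1Dual.norm_sq_mul_bracket (ξ g : M1 v) (ψ : M1Dual v) :
    ((‖(ξ : L2 d)‖ ^ 2 : ℝ) : ℂ) * ψ.bracket g =
      ∫ w, conj (TimeFreq.stft (ξ : L2 d) (g : L2 d) w) * ψ.stft ξ w := by
  obtain ⟨H, K, hH, hK, hrep⟩ := ψ.exists_density
  have hK0 : 0 ≤ K := nonneg_of_mul_nonneg_left ((norm_nonneg _).trans (hK 0))
    (zero_lt_one.trans_le (v.one_le 0))
  have e1 : ∀ w, conj (TimeFreq.stft (ξ : L2 d) (g : L2 d) w) * ψ.stft ξ w =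
      ∫ u, conj (TimeFreq.stft (ξ : L2 d) (g : L2 d) w) * (H u *
        conj (inner ℂ (tfShift u (gaussian d)) (tfShift w (ξ : L2 d)))) := fun w => by
    rw [integral_const_mul]
    congr 1
    exact hrep (m1Shift v w ξ)
  -- Fubini is allowed because $|H(u)|\le K\,v(w)\,v(u-w)$, while $V_\xi g$ and $V_{\varphi_0}\xi$
  -- both lie in $L^1_v$. The integral over `w` is then Moyal's identity with window `ξ`.
  have hi : Integrable (fun q : Phase d × Phase d =>
      conj (TimeFreq.stft (ξ : L2 d) (g : L2 d) q.1) * (H q.2 *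
        conj (inner ℂ (tfShift q.2 (gaussian d)) (tfShift q.1 (ξ : L2 d)))))
      (volume.prod volume) := by
    refine ((Integrable.mul_prod_sub_left (integrable_stft_mul_weight ξ g)
      (mem_M1.1 ξ.2)).const_mul K).mono' ?_ (ae_of_all _ fun q => ?_)
    · refine StronglyMeasurable.aestronglyMeasurable ?_
      have hc := ((continuous_inner_tfShift (gaussian d) (ξ : L2 d)).comp continuous_swap).star
      exact ((continuous_stft _ _).comp continuous_fst).star.stronglyMeasurable.mul
        ((hH.comp_measurable measurable_snd).mul hc.stronglyMeasurable)
    · have h1 : ‖inner ℂ (tfShift q.2 (gaussian d)) (tfShift q.1 (ξ : L2 d))‖ =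
          ‖TimeFreq.stft (gaussian d) (ξ : L2 d) (q.2 - q.1)‖ := norm_stft_tfShift _ _ _ _
      rw [norm_mul, norm_mul, RCLike.norm_conj, RCLike.norm_conj, h1]
      have h2 := (hK q.2).trans (mul_le_mul_of_nonneg_left (v.le_mul_sub q.2 q.1) hK0)
      calc _ ≤ ‖TimeFreq.stft (ξ : L2 d) (g : L2 d) q.1‖ * (K * (v q.1 * v (q.2 - q.1)) *
            ‖TimeFreq.stft (gaussian d) (ξ : L2 d) (q.2 - q.1)‖) := by gcongr
        _ = _ := by ring
  simp_rw [e1]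
  rw [integral_integral_swap hi, hrep g, ← integral_const_mul]
  refine integral_congr_ae (ae_of_all _ fun u => ?_)
  have h1 := congrArg conj
    (integral_stft_mul_conj (ξ : L2 d) (g : L2 d) (tfShift u (gaussian d)))
  rw [← integral_conj, map_mul, Complex.conj_ofReal] at h1
  have h2 : ∀ w, conj (TimeFreq.stft (ξ : L2 d) (g : L2 d) w) * (H u *
        conj (inner ℂ (tfShift u (gaussian d)) (tfShift w (ξ : L2 d)))) =
      H u * conj (TimeFreq.stft (ξ : L2 d) (g : L2 d) w *
        conj (TimeFreq.stft (ξ : L2 d) (tfShift u (gaussian d)) w)) := fun w => by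
    have : conj (TimeFreq.stft (ξ : L2 d) (tfShift u (gaussian d)) w) =
        inner ℂ (tfShift u (gaussian d)) (tfShift w (ξ : L2 d)) := inner_conj_symm _ _
    rw [this, map_mul]
    ring
  simp_rw [h2]
  rw [integral_const_mul, h1]
  unfold TimeFreq.stft
  ring

/-- The pointwise estimate for a change of window. -/
theorem M1Dual.enorm_stft_le (ξ g : M1 v) (ψ : M1Dual v) (z : Phase d) :
    ‖(ξ : L2 d)‖ₑ ^ 2 * ‖ψ.stft g z‖ₑ ≤
      ∫⁻ u, ‖TimeFreq.stft (ξ : L2 d) (g : L2 d) u‖ₑ * ‖ψ.stft ξ (z + u)‖ₑ := by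
  have h := ψ.norm_sq_mul_bracket ξ (m1Shift v z g)
  have e : ‖((‖(ξ : L2 d)‖ ^ 2 : ℝ) : ℂ) * ψ.stft g z‖ₑ = ‖(ξ : L2 d)‖ₑ ^ 2 * ‖ψ.stft g z‖ₑ := by
    rw [enorm_mul]
    congr 1
    push_cast
    rw [enorm_pow]
    congr 1
    rw [← ofReal_norm, Complex.norm_real, norm_norm, ofReal_norm]
  rw [← e, show ψ.stft g z = ψ.bracket (m1Shift v z g) from rfl, h]
  refine (enorm_integral_le_lintegral_enorm _).trans_eq ?_
  -- Substituting $w=z+u$ removes the shift from the kernel: $|V_\xi(\pi(z)g)(z+u)|=|V_\xi g(u)|$.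
  rw [← lintegral_add_left_eq_self _ z]
  refine lintegral_congr fun u => ?_
  rw [enorm_mul]
  congr 1
  change ‖conj (TimeFreq.stft (ξ : L2 d) (tfShift z (g : L2 d)) (z + u))‖ₑ = _
  rw [← ofReal_norm, ← ofReal_norm, RCLike.norm_conj, norm_stft_tfShift, add_sub_cancel_left]

end TimeFreq

namespace TimeFreq

variable {d : ℕ} {v : SubmultWeight d}

/-! ### Localization operators on `(M¹_v)'` -/

theorem inner_locOp (φ₁ φ₂ : L2 d) {f : Phase d → ℂ} (hf : Integrable f volume) (φ χ : L2 d) :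
    inner ℂ φ (locOp φ₁ φ₂ f χ) = ∫ w, f w * stft φ₁ χ w * inner ℂ φ (tfShift w φ₂) := by
  have hi : Integrable (fun w => (f w * stft φ₁ χ w) • tfShift w φ₂) volume := by
    refine (hf.norm.mul_const (‖φ₁‖ * ‖χ‖ * ‖φ₂‖)).mono'
      ((hf.1.mul (continuous_stft _ _).aestronglyMeasurable).smul
        (continuous_tfShift φ₂).aestronglyMeasurable) (ae_of_all _ fun w => ?_)
    rw [norm_smul, norm_mul, norm_tfShift, mul_assoc]
    gcongr
    exact norm_stft_le _ _ _
  rw [locOp_apply φ₁ φ₂ hf, ← integral_inner hi]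
  simp only [inner_smul_right]

theorem stft_adjoint_locOp (g φ₁ φ₂ : L2 d) {f : Phase d → ℂ} (hf : Integrable f volume)
    (φ : L2 d) (u : Phase d) :
    conj (stft g (ContinuousLinearMap.adjoint (locOp φ₁ φ₂ f) φ) u) =
      ∫ w, f w * stft φ₁ (tfShift u g) w * inner ℂ φ (tfShift w φ₂) := by
  rw [← inner_locOp φ₁ φ₂ hf, ← ContinuousLinearMap.adjoint_inner_left]
  exact inner_conj_symm _ _

/-- The extension of the localization operator to `(M¹_v)'` is given by the defining integral. -/
theorem isExtValue_locOp (φ₁ : M1 v) (φ₂ : L2 d) {f : Phase d → ℂ} (hf : MemL1 v f)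
    (ψ : M1Dual v) : IsExtValue (locOp (φ₁ : L2 d) φ₂ f) ψ
      (∫ w, (f w * ψ.stft φ₁ w) • tfShift w φ₂) := by
  intro φ
  have hmeas : AEStronglyMeasurable (fun q : Phase d × Phase d =>
      f q.1 * stft (φ₁ : L2 d) (tfShift q.2 (gaussian d)) q.1 * inner ℂ φ (tfShift q.1 φ₂))
      (volume.prod volume) := by
    refine (hf.1.comp_fst.mul (continuous_inner_tfShift (φ₁ : L2 d)
      (gaussian d)).aestronglyMeasurable).mul ?_
    exact (continuous_const.inner
      ((continuous_tfShift φ₂).comp continuous_fst)).aestronglyMeasurable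
  have hbase := (Integrable.mul_prod_sub_left hf.2 (mem_M1.1 φ₁.2)).const_mul (‖φ‖ * ‖φ₂‖)
  -- One majorant, integrable in $(w,u)$, serves twice: it puts $\mathcal A_f^*\phi$ in $M^1_v$, and
  -- it justifies the exchange of integrals once $|H|\le Kv$ is inserted.
  have hbd : ∀ w u : Phase d, ‖f w * stft (φ₁ : L2 d) (tfShift u (gaussian d)) w *
      inner ℂ φ (tfShift w φ₂)‖ * v u ≤ ‖φ‖ * ‖φ₂‖ *
        (‖f w‖ * v w * (‖stft (gaussian d) (φ₁ : L2 d) (u - w)‖ * v (u - w))) := fun w u => by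
    have h1 : ‖stft (φ₁ : L2 d) (tfShift u (gaussian d)) w‖ =
        ‖stft (gaussian d) (φ₁ : L2 d) (u - w)‖ := by
      rw [norm_stft_tfShift, ← norm_stft_neg, neg_sub]
    have h2 : ‖inner ℂ φ (tfShift w φ₂)‖ ≤ ‖φ‖ * ‖φ₂‖ :=
      (norm_inner_le_norm _ _).trans_eq (by rw [norm_tfShift])
    rw [norm_mul, norm_mul, h1]
    have h3 := v.le_mul_sub u w
    have := v.nonneg' u
    calc _ ≤ ‖f w‖ * ‖stft (gaussian d) (φ₁ : L2 d) (u - w)‖ * (‖φ‖ * ‖φ₂‖) *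
          (v w * v (u - w)) := by gcongr
      _ = _ := by ring
  have hM : ContinuousLinearMap.adjoint (locOp (φ₁ : L2 d) φ₂ f) φ ∈ M1 v := by
    rw [mem_M1]
    refine hbase.integral_prod_right.mono'
      ((continuous_stft _ _).norm.mul v.continuous').aestronglyMeasurable ?_
    filter_upwards [hbase.prod_left_ae] with u hu
    rw [Real.norm_of_nonneg (mul_nonneg (norm_nonneg _) (v.nonneg' u)), ← RCLike.norm_conj,
      stft_adjoint_locOp _ _ _ hf.integrable]
    calc _ = ‖∫ w, f w * stft (φ₁ : L2 d) (tfShift u (gaussian d)) w *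
          inner ℂ φ (tfShift w φ₂) * (v u : ℂ)‖ := by
          rw [integral_mul_const, norm_mul, Complex.norm_real,
            Real.norm_of_nonneg (v.nonneg' u)]
      _ ≤ _ := by
          refine norm_integral_le_of_norm_le hu (ae_of_all _ fun w => ?_)
          rw [norm_mul _ (v u : ℂ), Complex.norm_real, Real.norm_of_nonneg (v.nonneg' u)]
          exact hbd w u
  refine ⟨hM, ?_⟩
  obtain ⟨H, K, hH, hK, hrep⟩ := ψ.exists_density
  have hK0 : 0 ≤ K := nonneg_of_mul_nonneg_left ((norm_nonneg _).trans (hK 0))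
    (zero_lt_one.trans_le (v.one_le 0))
  obtain ⟨K', hK'⟩ := ψ.exists_norm_stft_le φ₁
  have hi : Integrable (fun w => (f w * ψ.stft φ₁ w) • tfShift w φ₂) volume := by
    refine (hf.2.mul_const (K' * ‖φ₂‖)).mono'
      ((hf.1.mul (ψ.stronglyMeasurable_stft φ₁).aestronglyMeasurable).smul
        (continuous_tfShift φ₂).aestronglyMeasurable) (ae_of_all _ fun w => ?_)
    rw [norm_smul, norm_mul, norm_tfShift]
    calc _ ≤ ‖f w‖ * (K' * v w) * ‖φ₂‖ := by gcongr; exact hK' w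
      _ = _ := by ring
  rw [← integral_inner hi, hrep]
  have e1 : ∀ u, H u * conj (stft (gaussian d)
      (ContinuousLinearMap.adjoint (locOp (φ₁ : L2 d) φ₂ f) φ) u) =
      ∫ w, H u * (f w * stft (φ₁ : L2 d) (tfShift u (gaussian d)) w *
        inner ℂ φ (tfShift w φ₂)) := fun u => by
    rw [stft_adjoint_locOp _ _ _ hf.integrable, integral_const_mul]
  have hi2 : Integrable (fun q : Phase d × Phase d => H q.2 *
      (f q.1 * stft (φ₁ : L2 d) (tfShift q.2 (gaussian d)) q.1 * inner ℂ φ (tfShift q.1 φ₂)))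
      (volume.prod volume) := by
    refine (hbase.const_mul K).mono'
      ((hH.comp_measurable measurable_snd).aestronglyMeasurable.mul hmeas)
      (ae_of_all _ fun q => ?_)
    rw [norm_mul]
    refine (mul_le_mul_of_nonneg_right (hK q.2) (norm_nonneg _)).trans ?_
    rw [mul_assoc, mul_comm (v q.2)]
    exact mul_le_mul_of_nonneg_left (hbd q.1 q.2) hK0
  simp_rw [e1]
  rw [← integral_integral_swap hi2]
  refine integral_congr_ae (ae_of_all _ fun w => ?_)
  have e2 : ψ.stft φ₁ w = ∫ u, H u * conj (stft (gaussian d) (tfShift w (φ₁ : L2 d)) u) :=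
    hrep (m1Shift v w φ₁)
  simp only [inner_smul_right]
  rw [e2, mul_right_comm, ← integral_const_mul]
  refine integral_congr_ae (ae_of_all _ fun u => ?_)
  have : conj (stft (gaussian d) (tfShift w (φ₁ : L2 d)) u) =
      stft (φ₁ : L2 d) (tfShift u (gaussian d)) w := inner_conj_symm _ _
  simp only [this]
  ring

theorem MemL1.translate {f : Phase d → ℂ} (hf : MemL1 v f) (z : Phase d) :
    MemL1 v (translate z f) := by
  have hm : AEStronglyMeasurable (TimeFreq.translate z f) volume :=
    hf.1.comp_measurePreserving (measurePreserving_sub_right volume z)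
  refine ⟨hm, ((hf.2.comp_sub_right z).mul_const (v z)).mono'
    (hm.norm.mul v.continuous'.aestronglyMeasurable) (ae_of_all _ fun w => ?_)⟩
  rw [Real.norm_of_nonneg (mul_nonneg (norm_nonneg _) (v.nonneg' w)), mul_assoc]
  refine mul_le_mul_of_nonneg_left ?_ (norm_nonneg _)
  simpa using v.submul' (w - z) z

theorem extend_locOp_translate (φ₁ : M1 v) (φ₂ : L2 d) {f : Phase d → ℂ} (hf : MemL1 v f)
    (ψ : M1Dual v) (z : Phase d) :
    extend (locOp (φ₁ : L2 d) φ₂ (translate z f)) ψ =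
      ∫ w, (f (w - z) * ψ.stft φ₁ w) • tfShift w φ₂ :=
  (isExtValue_locOp φ₁ φ₂ (hf.translate z) ψ).extend_eq

theorem aestronglyMeasurable_extend_locOp (φ₁ : M1 v) (φ₂ : L2 d) {f : Phase d → ℂ}
    (hf : MemL1 v f) (ψ : M1Dual v) :
    AEStronglyMeasurable (fun z : Phase d =>
      extend (locOp (φ₁ : L2 d) φ₂ (translate z f)) ψ) volume := by
  simp_rw [extend_locOp_translate φ₁ φ₂ hf ψ]
  -- `f` is only almost everywhere strongly measurable, so composing it with a difference requires
  -- preimages of null sets to be null.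
  have hq : Measure.QuasiMeasurePreserving (fun q : Phase d × Phase d => q.2 - q.1)
      (volume.prod volume) volume :=
    (quasiMeasurePreserving_sub_of_right_invariant volume volume).comp
      Measure.measurePreserving_swap.quasiMeasurePreserving
  have h : AEStronglyMeasurable (fun q : Phase d × Phase d =>
      (f (q.2 - q.1) * ψ.stft φ₁ q.2) • tfShift q.2 φ₂) (volume.prod volume) :=
    ((hf.1.comp_quasiMeasurePreserving hq).mul
      ((ψ.stronglyMeasurable_stft φ₁).comp_measurable measurable_snd).aestronglyMeasurable).smul
      ((continuous_tfShift φ₂).comp continuous_snd).aestronglyMeasurable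
  exact h.integral_prod_right'

/-- The norm passes inside the defining integral, the shifts are isometric, and $w=z+u$ exhibits a
correlation to which Young's inequality applies. -/
theorem enorm_extend_locOp_le (φ₁ : M1 v) (φ₂ : L2 d) {f : Phase d → ℂ} (hf : MemL1 v f)
    (ψ : M1Dual v) (z : Phase d) :
    ‖extend (locOp (φ₁ : L2 d) φ₂ (translate z f)) ψ‖ₑ ≤
      ∫⁻ u, ‖φ₂‖ₑ * ‖f u‖ₑ * ‖ψ.stft φ₁ (z + u)‖ₑ := by
  rw [extend_locOp_translate φ₁ φ₂ hf ψ]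
  refine (enorm_integral_le_lintegral_enorm _).trans_eq ?_
  rw [← lintegral_add_left_eq_self _ z]
  refine lintegral_congr fun u => ?_
  rw [enorm_smul, enorm_mul, add_sub_cancel_left, ← ofReal_norm (tfShift _ _), norm_tfShift,
    ofReal_norm]
  ring

/-- Covariance of the localization operators. -/
theorem adjoint_locOp_translate (φ₁ φ₂ : L2 d) {f : Phase d → ℂ} (hf : Integrable f volume)
    (z : Phase d) (φ : L2 d) :
    ContinuousLinearMap.adjoint (locOp φ₁ φ₂ (translate z f)) (tfShift z φ) =
      tfShift z (ContinuousLinearMap.adjoint (locOp φ₁ φ₂ f) φ) := by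
  refine ext_inner_right ℂ fun χ => ?_
  obtain ⟨χ, rfl⟩ := tfShift_surjective z χ
  have hf' : Integrable (translate z f) volume := hf.comp_sub_right z
  rw [inner_tfShift_tfShift, ContinuousLinearMap.adjoint_inner_left,
    ContinuousLinearMap.adjoint_inner_left, inner_locOp _ _ hf', inner_locOp _ _ hf,
    ← integral_add_left_eq_self _ z]
  refine integral_congr_ae (ae_of_all _ fun u => ?_)
  have h1 : translate z f (z + u) = f u := by simp [translate]
  simp only [h1, stft, tfShift_add, inner_smul_left, inner_smul_right, inner_tfShift_tfShift]
  -- The composition law contributes one phase through $\varphi_1$ and its conjugate through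
  -- $\varphi_2$; they cancel.
  linear_combination (f u * inner ℂ (tfShift u φ₁) χ * inner ℂ φ (tfShift u φ₂)) *
    conj_character_mul_self u.2 z.1

/-- The core of the lower bound: with $\xi=\mathcal A_f^*\phi$, covariance gives $\pi(z)\xi=\mathcal
A_{T_zf}^*\pi(z)\phi$. Duality then turns $V_\xi\psi(z)$ into an $L^2$ inner product of $\mathcal
A_{T_zf}\psi$ with $\pi(z)\phi$, and Cauchy–Schwarz applies. -/
theorem enorm_stft_adjoint_le (φ₁ : M1 v) (φ₂ : L2 d) {f : Phase d → ℂ} (hf : MemL1 v f)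
    (ψ : M1Dual v) (φ : L2 d)
    (hξ : ContinuousLinearMap.adjoint (locOp (φ₁ : L2 d) φ₂ f) φ ∈ M1 v) (z : Phase d) :
    ‖ψ.stft ⟨_, hξ⟩ z‖ₑ ≤ ‖φ‖ₑ * ‖extend (locOp (φ₁ : L2 d) φ₂ (translate z f)) ψ‖ₑ := by
  have hw := isExtValue_locOp φ₁ φ₂ (hf.translate z) ψ
  rw [hw.extend_eq]
  obtain ⟨h, e⟩ := hw (tfShift z φ)
  have e2 : ψ.stft ⟨_, hξ⟩ z = ψ.bracket ⟨_, h⟩ := by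
    unfold M1Dual.stft m1Shift
    congr 2
    exact (adjoint_locOp_translate (φ₁ : L2 d) φ₂ hf.integrable z φ).symm
  rw [e2, ← e, ← ofReal_norm, ← ofReal_norm, ← ofReal_norm, ← ENNReal.ofReal_mul (norm_nonneg _)]
  refine ENNReal.ofReal_le_ofReal ((norm_inner_le_norm _ _).trans_eq ?_)
  rw [norm_tfShift]

theorem measurable_weight (v : SubmultWeight d) : Measurable fun z => ENNReal.ofReal (v z) :=
  ENNReal.measurable_ofReal.comp v.continuous'.measurable

theorem lintegral_enorm_mul_weight_ne_top {X : Type*} [NormedAddCommGroup X] {F : Phase d → X}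
    (h : Integrable (fun z => ‖F z‖ * v z) volume) :
    ∫⁻ z, ‖F z‖ₑ * ENNReal.ofReal (v z) ≠ ∞ := by
  refine (lt_of_eq_of_lt (lintegral_congr fun z => ?_) h.2).ne
  rw [enorm_mul, enorm_norm, Real.enorm_of_nonneg (v.nonneg' z)]

/-- Change of window in weighted mixed norms. -/
theorem M1Dual.emixedNorm_stft_le {p q : ℝ≥0∞} (hp : 1 ≤ p) (hq : 1 ≤ q) {M : Phase d → ℝ≥0∞}
    (hM : Measurable M) (hMv : ∀ z u, M z ≤ ENNReal.ofReal (v u) * M (z + u)) (ξ g : M1 v)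
    (hξ : (ξ : L2 d) ≠ 0) : ∃ D : ℝ≥0∞, D ≠ ∞ ∧ ∀ ψ : M1Dual v,
      emixedNorm p q (fun z => M z * ‖ψ.stft g z‖ₑ) ≤
        D * emixedNorm p q (fun z => M z * ‖ψ.stft ξ z‖ₑ) := by
  have h0 : ‖(ξ : L2 d)‖ₑ ^ 2 ≠ 0 := pow_ne_zero _ (by simpa using hξ)
  have ht : ‖(ξ : L2 d)‖ₑ ^ 2 ≠ ∞ := ENNReal.pow_ne_top enorm_ne_top
  have hc : (‖(ξ : L2 d)‖ₑ ^ 2)⁻¹ ≠ ∞ := ENNReal.inv_ne_top.2 h0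
  -- The constant is $\|\xi\|^{-2}\,\|V_\xi g\|_{L^1_v}$: the factor from the pointwise change of
  -- window times the one from Young's inequality.
  refine ⟨(‖(ξ : L2 d)‖ₑ ^ 2)⁻¹ * ∫⁻ u, ‖TimeFreq.stft (ξ : L2 d) (g : L2 d) u‖ₑ *
    ENNReal.ofReal (v u), ENNReal.mul_ne_top hc
      (lintegral_enorm_mul_weight_ne_top (integrable_stft_mul_weight ξ g)), fun ψ => ?_⟩
  rw [mul_assoc]
  refine le_trans ?_ (mul_le_mul_right (emixedNorm_correlation_le hp hq hM (measurable_weight v)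
    (continuous_stft (ξ : L2 d) (g : L2 d)).enorm.measurable
    (ψ.stronglyMeasurable_stft ξ).enorm
    (fun u => ENNReal.mul_ne_top enorm_ne_top ENNReal.ofReal_ne_top) hMv) _)
  refine (emixedNorm_mono fun z => ?_).trans (emixedNorm_const_mul_le hc _)
  rw [mul_left_comm]
  gcongr
  rw [mul_comm, ← div_eq_mul_inv, ENNReal.le_div_iff_mul_le (.inl h0) (.inl ht), mul_comm]
  exact ψ.enorm_stft_le ξ g z

theorem exists_adjoint_apply_ne_zero {S : L2 d →L[ℂ] L2 d} (hS : S ≠ 0) :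
    ∃ φ, ContinuousLinearMap.adjoint S φ ≠ 0 := by
  by_contra! h
  refine hS ?_
  rw [← ContinuousLinearMap.adjoint_adjoint S, show ContinuousLinearMap.adjoint S = 0 from
    ContinuousLinearMap.ext h, map_zero]

end TimeFreq

/-! ### The two-sided estimate -/

namespace TimeFreq

variable {d : ℕ} {v : SubmultWeight d}

/-- The window adapted to the operator is $\xi=\mathcal A_f^*\phi\neq0$; the change of window from
`ξ` to the Gaussian does the rest. -/
theorem exists_emixedNorm_stft_le_locOp {p q : ℝ≥0∞} (hp : 1 ≤ p) (hq : 1 ≤ q)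
    {M : Phase d → ℝ≥0∞} (hM : Measurable M)
    (hMv : ∀ z u, M z ≤ ENNReal.ofReal (v u) * M (z + u)) (φ₁ : M1 v) (φ₂ : L2 d)
    {f : Phase d → ℂ} (hf : MemL1 v f) (hne : locOp (φ₁ : L2 d) φ₂ f ≠ 0) :
    ∃ D : ℝ≥0∞, D ≠ ∞ ∧ ∀ ψ : M1Dual v,
      emixedNorm p q (fun z => M z * ‖ψ.stft (m1Gaussian v) z‖ₑ) ≤ D *
        emixedNorm p q (fun z => M z * ‖extend (locOp (φ₁ : L2 d) φ₂ (translate z f)) ψ‖ₑ) := by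
  obtain ⟨φ, hφ⟩ := exists_adjoint_apply_ne_zero hne
  -- The zero functional serves only to extract from `isExtValue_locOp` that $\mathcal A_f^*\phi\in
  -- M^1_v$, a fact independent of `ψ`.
  let ψ₀ : M1Dual v := ⟨0, 0, fun _ => by simp⟩
  obtain ⟨hξ, -⟩ := isExtValue_locOp φ₁ φ₂ hf ψ₀ φ
  obtain ⟨D, hD, h⟩ := M1Dual.emixedNorm_stft_le hp hq hM hMv ⟨_, hξ⟩ (m1Gaussian v) hφ
  refine ⟨D * ‖φ‖ₑ, ENNReal.mul_ne_top hD enorm_ne_top, fun ψ => (h ψ).trans ?_⟩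
  rw [mul_assoc]
  gcongr
  refine (emixedNorm_mono fun z => ?_).trans (emixedNorm_const_mul_le enorm_ne_top _)
  rw [mul_left_comm]
  gcongr
  exact enorm_stft_adjoint_le φ₁ φ₂ hf ψ φ hξ z

theorem exists_emixedNorm_locOp_le_stft {p q : ℝ≥0∞} (hp : 1 ≤ p) (hq : 1 ≤ q)
    {M : Phase d → ℝ≥0∞} (hM : Measurable M)
    (hMv : ∀ z u, M z ≤ ENNReal.ofReal (v u) * M (z + u)) (φ₁ : M1 v) (φ₂ : L2 d)
    {f : Phase d → ℂ} (hf : MemL1 v f) :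
    ∃ D : ℝ≥0∞, D ≠ ∞ ∧ ∀ ψ : M1Dual v,
      emixedNorm p q (fun z => M z * ‖extend (locOp (φ₁ : L2 d) φ₂ (translate z f)) ψ‖ₑ) ≤
        D * emixedNorm p q (fun z => M z * ‖ψ.stft (m1Gaussian v) z‖ₑ) := by
  obtain ⟨D, hD, h⟩ :=
    M1Dual.emixedNorm_stft_le hp hq hM hMv (m1Gaussian v) φ₁ (gaussian_ne_zero d)
  -- Young's inequality is stated for Borel kernels, so `f` is replaced by a measurable
  -- representative, which changes none of the integrals.
  set f' := hf.1.mk f with hf'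
  have hfm : Measurable fun u => ‖φ₂‖ₑ * ‖f' u‖ₑ :=
    hf.1.stronglyMeasurable_mk.enorm.const_mul _
  refine ⟨(∫⁻ u, ‖φ₂‖ₑ * ‖f' u‖ₑ * ENNReal.ofReal (v u)) * D, ENNReal.mul_ne_top ?_ hD,
    fun ψ => ?_⟩
  · simp_rw [mul_assoc]
    rw [lintegral_const_mul' _ _ enorm_ne_top]
    refine ENNReal.mul_ne_top enorm_ne_top ?_
    have e : ∫⁻ u, ‖f' u‖ₑ * ENNReal.ofReal (v u) = ∫⁻ u, ‖f u‖ₑ * ENNReal.ofReal (v u) := by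
      refine lintegral_congr_ae ?_
      filter_upwards [hf.1.ae_eq_mk] with u hu
      rw [hu]
    exact e ▸ lintegral_enorm_mul_weight_ne_top hf.2
  · rw [mul_assoc]
    refine le_trans ?_ (mul_le_mul_right (h ψ) _)
    refine le_trans (emixedNorm_mono fun z => ?_)
      (emixedNorm_correlation_le hp hq hM (measurable_weight v) hfm
        (ψ.stronglyMeasurable_stft φ₁).enorm (fun u => ENNReal.mul_ne_top
          (ENNReal.mul_ne_top enorm_ne_top enorm_ne_top) ENNReal.ofReal_ne_top) hMv)
    gcongr
    refine (enorm_extend_locOp_le φ₁ φ₂ hf ψ z).trans_eq (lintegral_congr_ae ?_)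
    filter_upwards [hf.1.ae_eq_mk] with u hu
    rw [hu]

/-- Adding `1` keeps the constant invertible when `D = 0`. -/
theorem ofReal_inv_mul_le {D X Y : ℝ≥0∞} (hD : D ≠ ∞) (h : X ≤ D * Y) :
    ENNReal.ofReal (D.toReal + 1)⁻¹ * X ≤ Y := by
  have h0 : 0 < D.toReal + 1 := by positivity
  rw [ENNReal.ofReal_inv_of_pos h0, ENNReal.inv_mul_le_iff (by simpa using h0) (by simp)]
  exact h.trans (mul_le_mul_left (ENNReal.le_ofReal_iff_toReal_le hD h0.le |>.2 (by linarith)) _)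

end TimeFreq

end

theorem mainTheorem4 {d : ℕ} (v : TimeFreq.SubmultWeight d) (φ₁ : TimeFreq.M1 v)
    (φ₂ : TimeFreq.L2 d) (f : TimeFreq.Phase d → ℂ) (hf : TimeFreq.MemL1 v f)
    (hne : TimeFreq.locOp (φ₁ : TimeFreq.L2 d) φ₂ f ≠ 0)
    (p q : ℝ≥0∞) (hp : 1 ≤ p) (hq : 1 ≤ q)
    (m : TimeFreq.Phase d → ℝ) (hm : TimeFreq.IsModerate v m) :
    (∀ ψ : TimeFreq.M1Dual v,
      AEStronglyMeasurable (fun z : TimeFreq.Phase d =>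
        TimeFreq.extend (TimeFreq.locOp (φ₁ : TimeFreq.L2 d) φ₂ (TimeFreq.translate z f)) ψ)
        volume) ∧
    ∃ c C : ℝ, 0 < c ∧ 0 < C ∧ ∀ ψ : TimeFreq.M1Dual v,
      ENNReal.ofReal c * TimeFreq.modNorm p q m ψ ≤
        TimeFreq.mixedNorm p q m (fun z : TimeFreq.Phase d =>
          TimeFreq.extend (TimeFreq.locOp (φ₁ : TimeFreq.L2 d) φ₂ (TimeFreq.translate z f)) ψ) ∧
      TimeFreq.mixedNorm p q m (fun z : TimeFreq.Phase d =>
          TimeFreq.extend (TimeFreq.locOp (φ₁ : TimeFreq.L2 d) φ₂ (TimeFreq.translate z f)) ψ) ≤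
        ENNReal.ofReal C * TimeFreq.modNorm p q m ψ := by

  refine ⟨TimeFreq.aestronglyMeasurable_extend_locOp φ₁ φ₂ hf, ?_⟩
  obtain ⟨M, a, b, -, -, hM, hMv, hmM, hMm⟩ := hm.exists_measurable
  obtain ⟨D₁, hD₁, h₁⟩ :=
    TimeFreq.exists_emixedNorm_stft_le_locOp hp hq hM hMv φ₁ φ₂ hf hne
  obtain ⟨D₂, hD₂, h₂⟩ := TimeFreq.exists_emixedNorm_locOp_le_stft hp hq hM hMv φ₁ φ₂ hf
  -- The estimates hold for the regularized weight `M`; returning to `m` costs the factor `a` on the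
  -- left norm and `b` on the right one.
  have htransfer : ∀ {X Y : Type} [NormedAddCommGroup X] [NormedAddCommGroup Y] {D : ℝ≥0∞}
      {F : TimeFreq.Phase d → X} {G : TimeFreq.Phase d → Y},
      TimeFreq.emixedNorm p q (fun z => M z * ‖F z‖ₑ) ≤
        D * TimeFreq.emixedNorm p q (fun z => M z * ‖G z‖ₑ) →
      TimeFreq.mixedNorm p q m F ≤
        ENNReal.ofReal a * D * ENNReal.ofReal b * TimeFreq.mixedNorm p q m G := by
    intro X Y _ _ D F G h
    rw [TimeFreq.mixedNorm_eq_emixedNorm p q hm.nonneg,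
      TimeFreq.mixedNorm_eq_emixedNorm p q hm.nonneg]
    calc _ ≤ TimeFreq.emixedNorm p q (fun z => ENNReal.ofReal a * (M z * ‖F z‖ₑ)) :=
          TimeFreq.emixedNorm_mono fun z => by rw [← mul_assoc]; gcongr; exact hmM z
      _ ≤ ENNReal.ofReal a * (D * TimeFreq.emixedNorm p q (fun z => M z * ‖G z‖ₑ)) :=
          (TimeFreq.emixedNorm_const_mul_le ENNReal.ofReal_ne_top _).trans (by gcongr)
      _ ≤ ENNReal.ofReal a * (D * TimeFreq.emixedNorm p q
            (fun z => ENNReal.ofReal b * (ENNReal.ofReal (m z) * ‖G z‖ₑ))) := by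
          gcongr
          exact TimeFreq.emixedNorm_mono fun z => by rw [← mul_assoc]; gcongr; exact hMm z
      _ ≤ ENNReal.ofReal a * (D * (ENNReal.ofReal b * TimeFreq.emixedNorm p q
            (fun z => ENNReal.ofReal (m z) * ‖G z‖ₑ))) := by
          gcongr
          exact TimeFreq.emixedNorm_const_mul_le ENNReal.ofReal_ne_top _
      _ = _ := by ring
  have hfin : ∀ {D : ℝ≥0∞}, D ≠ ∞ → ENNReal.ofReal a * D * ENNReal.ofReal b ≠ ∞ := fun h =>
    ENNReal.mul_ne_top (ENNReal.mul_ne_top ENNReal.ofReal_ne_top h) ENNReal.ofReal_ne_top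
  refine ⟨((ENNReal.ofReal a * D₁ * ENNReal.ofReal b).toReal + 1)⁻¹,
    (ENNReal.ofReal a * D₂ * ENNReal.ofReal b).toReal + 1, by positivity, by positivity,
    fun ψ => ⟨TimeFreq.ofReal_inv_mul_le (hfin hD₁) (htransfer (h₁ ψ)),
      (htransfer (h₂ ψ)).trans (mul_le_mul_left ?_ _)⟩⟩
  exact ENNReal.le_ofReal_iff_toReal_le (hfin hD₂) (by positivity) |>.2 (by linarith)
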